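/- Let $K\subset\mathbb R^2$ be a compact strictly convex set bounded by a curve $\Gamma=\partial K$ of class $\mathcal C^2$. By this we mean that $K$ is a nonempty compact convex set whose support function $p(\varphi)=\sup_{x\in K}\langle x,N(\varphi)\rangle$, $N(\varphi)=(\cos\varphi,\sin\varphi)$, is of class $\mathcal C^2$ with $p+p''>0$ everywhere. Let $F$ be the area of $K$, $L$ the length of $\Gamma$, and $\Delta=L^2-4\pi F$. For a $2\pi$-periodic $\mathcal C^1$ function $f$, the envelope of the lines $\langle x,N(t)\rangle=f(t)$ is called the curve with generalized support function $f$, and the area with multiplicities that it encloses is $\frac12\int_0^{2\pi}(f^2-f'^2)\,dt$. Let $F_e$ be the area with multiplicities enclosed by the evolute of $\Gamma$, that is, by the envelope of the normal lines of $\Gamma$, whose generalized support function is $p'(t-\pi/2)$. For $P\notin K$ let $\omega=\omega(P)$ be the visual angle of $\Gamma$ from $P$, the angle between the two tangents from $P$ to $\Gamma$, and let $dP$ be the area measure. Let $\delta_2(K)$ be the distance in $L^2(S^1)$ between the support function of $K$ and that of its Steiner disk, the disk centred at $s(K)=\frac1\pi\int_0^{2\pi}p(\varphi)N(\varphi)\,d\varphi$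 whose diameter is the mean width of $K$. Then $\sin^3\omega$ is integrable over $\mathbb R^2\setminus K$ and $$\pi|F_e|-\Delta\ \ge\ 20\left(\pi\,\delta_2(K)^2+\frac{L^2}{3}-\frac49\int_{P\notin K}\sin^3\omega\,dP\right).$$ The right-hand side is strictly positive except when $\pi|F_e|-\Delta=0$, in which case it also vanishes. Equality holds if and only if one of the following is true: a) $K$ is a disk, or it is bounded by a curve parallel to an astroid (a hypocycloid with $4$ cusps); b) $K$ is bounded by a curve parallel to a Steiner curve (a hypocycloid with $3$ cusps); c) $K$ is the Minkowski sum of two or more domains of the above types, where the domains bounded by curves parallel to an astroid or a Steiner curve need not be convex, and the Minkowski sum is understood in the sense that the support function of $K$ is the sum of the generalized support functions of the summands. Here a curve is parallel to a hypocycloid if its generalized support function is that of the hypocycloid, in any position and of any size, plus a real constant. -/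

import Mathlib

open Real MeasureTheory
open scoped RealInnerProductSpace

namespace PlaneConvex

noncomputable section

/-- The Euclidean plane. -/
abbrev Plane : Type := EuclideanSpace ℝ (Fin 2)

/-- The unit vector `N(φ) = (cos φ, sin φ)`. -/
def normalVec (φ : ℝ) : Plane := !₂[cos φ, sin φ]

/-- The derivative `N'(φ) = (-sin φ, cos φ)` of `N`. -/
def tangentVec (φ : ℝ) : Plane := !₂[-sin φ, cos φ]

/-- The support function `p(φ) = sup {⟨x, N(φ)⟩ : x ∈ K}` of a set `K` in the plane. -/
def supportFn (K : Set Plane) (φ : ℝ) : ℝ := sSup ((fun x : Plane => ⟪x, normalVec φ⟫) '' K)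

/-- The envelope `f N + f' N'` of the family of lines `⟨x, N(t)⟩ = f(t)`: the curve whose
generalized support function is `f`. -/
def envelope (f : ℝ → ℝ) (t : ℝ) : Plane := f t • normalVec t + deriv f t • tangentVec t

/-- The boundary curve `Γ = ∂K`, parametrized by the direction `φ ∈ [0, 2π]` of its outer normal. -/
def boundaryCurve (K : Set Plane) : ℝ → Plane := envelope (supportFn K)

/-- The length `L` of the closed curve `Γ = ∂K`. -/
def boundaryLength (K : Set Plane) : ℝ := ∫ φ in (0 : ℝ)..(2 * π), ‖deriv (boundaryCurve K) φ‖

/-- The area `F` of `K`. -/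
def area (K : Set Plane) : ℝ := (volume K).toReal

/-- The isoperimetric deficit `Δ = L² - 4πF`. -/
def isoDeficit (K : Set Plane) : ℝ := boundaryLength K ^ 2 - 4 * π * area K

/-- The area with multiplicities enclosed by the closed curve with `2π`-periodic generalized support
function `f`, in the form `(1/2) ∫ (f² - f'²)` that makes sense for `f` of class `C¹`. For `f` of
class `C²` it equals `(1/2) ∫ f (f + f'')`, see `signedArea_eq`. -/
def signedArea (f : ℝ → ℝ) : ℝ := (1 / 2) * ∫ t in (0 : ℝ)..(2 * π), (f t ^ 2 - deriv f t ^ 2)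

/-- For `C²` functions, `signedArea f` is the area `(1/2) ∫ f (f + f'')` swept by the radius vector
of the envelope. -/
theorem signedArea_eq (f : ℝ → ℝ) (hf : ContDiff ℝ 2 f) (hper : Function.Periodic f (2 * π)) :
    signedArea f = (1 / 2) * ∫ t in (0 : ℝ)..(2 * π), f t * (f t + deriv (deriv f) t) := by
  have h1 : ContDiff ℝ 1 (deriv f) := ((contDiff_succ_iff_deriv (n := 1)).1 (by rw [one_add_one_eq_two]; exact hf)).2.2
  have hd : Differentiable ℝ f := hf.differentiable (by norm_num)
  have hd' : Differentiable ℝ (deriv f) := h1.differentiable (by norm_num)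
  have hc'' : Continuous (deriv (deriv f)) := h1.continuous_deriv (by norm_num)
  have hperd : deriv f (2 * π) = deriv f 0 := by
    have : (fun x => f (x + 2 * π)) = f := funext hper
    have h2 := deriv_comp_add_const f (2 * π) 0
    rw [this] at h2
    simpa using h2.symm
  have hper0 : f (2 * π) = f 0 := by simpa using hper 0
  have hparts := intervalIntegral.integral_mul_deriv_eq_deriv_mul (a := 0) (b := 2 * π)
    (fun x _ => (hd x).hasDerivAt) (fun x _ => (hd' x).hasDerivAt)
    (h1.continuous.intervalIntegrable 0 (2 * π)) (hc''.intervalIntegrable 0 (2 * π))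
  have hi : ∀ g : ℝ → ℝ, Continuous g → IntervalIntegrable g volume 0 (2 * π) :=
    fun g hg => hg.intervalIntegrable _ _
  have hfc := hd.continuous
  have hfc' := hd'.continuous
  unfold signedArea
  congr 1
  have e : (fun t => f t * (f t + deriv (deriv f) t))
      = fun t => f t ^ 2 + f t * deriv (deriv f) t := by
    funext t; ring
  rw [e, intervalIntegral.integral_add (hi _ (by fun_prop)) (hi _ (by fun_prop)),
    intervalIntegral.integral_sub (hi _ (by fun_prop)) (hi _ (by fun_prop)), hparts, hperd, hper0]
  simp only [pow_two]
  ring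

/-- The evolute of `Γ` is the envelope of its normal lines. The normal line at the point with outer
normal `N(t - π/2)` passes through that point and is orthogonal to `N(t)`, so that this function is
the generalized support function of the evolute. -/
def evoluteSupportFn (K : Set Plane) (t : ℝ) : ℝ := ⟪boundaryCurve K (t - π / 2), normalVec t⟫

/-- The area with multiplicities `F_e` enclosed by the evolute of `Γ`. -/
def evoluteArea (K : Set Plane) : ℝ := signedArea (evoluteSupportFn K)

/-- The points at which the support lines of `K` through `P` touch `K`. -/
def tangencyPoints (K : Set Plane) (P : Plane) : Set Plane :=
  {x | x ∈ K ∧ ∃ φ : ℝ, ⟪x, normalVec φ⟫ = supportFn K φ ∧ ⟪P, normalVec φ⟫ = supportFn K φ}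

/-- The visual angle `ω` of `Γ` from an exterior point `P`: the angle between the two tangents from
`P` to `Γ`. The set below consists of `0` and of the angle at `P` between the two tangency points. -/
def visualAngle (K : Set Plane) (P : Plane) : ℝ :=
  sSup {θ : ℝ | ∃ x ∈ tangencyPoints K P, ∃ y ∈ tangencyPoints K P, θ = EuclideanGeometry.angle x P y}

/-- The Steiner point `s(K) = (1/π) ∫ p(φ) N(φ) dφ`. -/
def steinerPoint (K : Set Plane) : Plane :=
  (1 / π) • ∫ φ in (0 : ℝ)..(2 * π), supportFn K φ • normalVec φ

/-- The mean over all directions of the width `p(φ) + p(φ + π)` of `K`. -/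
def meanWidth (K : Set Plane) : ℝ :=
  (1 / (2 * π)) * ∫ φ in (0 : ℝ)..(2 * π), (supportFn K φ + supportFn K (φ + π))

/-- The Steiner disk: its center is the Steiner point, its diameter the mean width. -/
def steinerDisk (K : Set Plane) : Set Plane := Metric.closedBall (steinerPoint K) (meanWidth K / 2)

/-- The distance in `L²(S¹)` between the support functions of `K` and of its Steiner disk. -/
def deltaTwo (K : Set Plane) : ℝ :=
  √(∫ φ in (0 : ℝ)..(2 * π), (supportFn K φ - supportFn (steinerDisk K) φ) ^ 2)

/-- The Hurwitz deficit `π|F_e| - Δ`. -/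
def hurwitzDeficit (K : Set Plane) : ℝ := π * |evoluteArea K| - isoDeficit K

/-- The lower bound `20 (π δ₂(K)² + L²/3 - (4/9) ∫_{P ∉ K} sin³ ω dP)`. -/
def deficitBound (K : Set Plane) : ℝ :=
  20 * (π * deltaTwo K ^ 2 + boundaryLength K ^ 2 / 3
    - (4 / 9) * ∫ P in Kᶜ, sin (visualAngle K P) ^ 3)

/-- The hypocycloid with parameters `k` and `r`, traced by a point of a circle of radius `r` that
rolls inside a circle of radius `k r`. -/
def hypocycloid (k r t : ℝ) : Plane :=
  !₂[r * (k - 1) * sin t - r * sin ((k - 1) * t), r * (k - 1) * cos t + r * cos ((k - 1) * t)]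

/-- The generalized support function of `hypocycloid k r`, see `envelope_hypocycloidSupportFn`. -/
def hypocycloidSupportFn (k r θ : ℝ) : ℝ := r * (k - 2) * sin (k / (k - 2) * θ)

theorem envelope_hypocycloidSupportFn (k r : ℝ) (hk : 2 < k) (t : ℝ) :
    envelope (hypocycloidSupportFn k r) ((k - 2) / 2 * t) = hypocycloid k r t := by
  have hk' : k - 2 ≠ 0 := by linarith
  have hder : ∀ θ, deriv (hypocycloidSupportFn k r) θ = r * k * cos (k / (k - 2) * θ) := by
    intro θ
    have h := (((hasDerivAt_id θ).const_mul (k / (k - 2))).sin).const_mul (r * (k - 2))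
    have h' : HasDerivAt (hypocycloidSupportFn k r)
        (r * (k - 2) * (cos (k / (k - 2) * id θ) * (k / (k - 2) * 1))) θ := h
    rw [h'.deriv]
    simp only [id]
    field_simp
  have ha : k / (k - 2) * ((k - 2) / 2 * t) = (k - 2) / 2 * t + t := by field_simp; ring
  have hb : (k - 1) * t = 2 * ((k - 2) / 2 * t) + t := by ring
  have hs := sin_sq_add_cos_sq ((k - 2) / 2 * t)
  set u := (k - 2) / 2 * t with hu
  unfold envelope
  rw [hder, hypocycloidSupportFn, hypocycloid, ha, hb]
  ext i
  fin_cases i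
  · simp [normalVec, tangentVec, sin_add, cos_add, sin_two_mul, cos_two_mul]
    linear_combination (k * r * sin t) * hs
  · simp [normalVec, tangentVec, sin_add, cos_add, sin_two_mul, cos_two_mul]
    linear_combination (r * (k - 2) * cos t) * hs

/-- `h` is the generalized support function of a curve that is parallel, at some distance `d`, to a
hypocycloid with parameter `k` in arbitrary position (rotated by `α` and translated by `c`). For
`k = 3` the hypocycloid is a Steiner curve (deltoid), for `k = 4` an astroid. -/
def IsParallelToHypocycloid (k : ℝ) (h : ℝ → ℝ) : Prop :=
  ∃ r : ℝ, 0 < r ∧ ∃ (α d : ℝ) (c : Plane),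
    ∀ θ, h θ = ⟪c, normalVec θ⟫ + hypocycloidSupportFn k r (θ - α) + d

/-- `K` is a disk. -/
def IsDisk (K : Set Plane) : Prop := ∃ (c : Plane) (R : ℝ), 0 < R ∧ K = Metric.closedBall c R

/-- `K` is bounded by a curve parallel to an astroid. The boundary curve is the envelope with
generalized support function `supportFn K`. -/
def IsBoundedByAstroidParallel (K : Set Plane) : Prop := IsParallelToHypocycloid 4 (supportFn K)

/-- `K` is bounded by a curve parallel to a Steiner curve. -/
def IsBoundedBySteinerParallel (K : Set Plane) : Prop := IsParallelToHypocycloid 3 (supportFn K)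

/-- `h` is the support function of a disk or the generalized support function of a curve, possibly
not convex, that is parallel to an astroid or to a Steiner curve. -/
def IsSummandSupportFn (h : ℝ → ℝ) : Prop :=
  (∃ D : Set Plane, IsDisk D ∧ h = supportFn D) ∨
    IsParallelToHypocycloid 4 h ∨ IsParallelToHypocycloid 3 h

/-- `K` is a Minkowski sum of two or more domains, not necessarily convex, that are disks or bounded
by curves parallel to an astroid or to a Steiner curve. For such domains Minkowski addition is
addition of the generalized support functions. -/
def IsMinkowskiSumOfSummands (K : Set Plane) : Prop :=
  ∃ (m : ℕ) (h : Fin m → ℝ → ℝ), 2 ≤ m ∧ (∀ i, IsSummandSupportFn (h i)) ∧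
    ∀ φ, supportFn K φ = ∑ i, h i φ

end

end PlaneConvex

open PlaneConvex

namespace PlaneConvex

/-! Everything is read off from the Fourier coefficients of the support function p. Write `power p
n` for the squared modulus of the unnormalised n-th coefficient. The length is the zeroth
coefficient, and Parseval gives 4π · `signedArea f` = Σ (1 - n²) `power f n` (`hasSum_signedArea`).
Applied to p and to p', this makes the Hurwitz deficit the sum over |n| ≥ 3 of (n² - 1)(n² - 4)/4 ·
`power p n` (`hasSum_hurwitzDeficit`): the weight vanishes at ±1 and ±2, and L² removes the term n =
0. That `signedArea p` is the Lebesgue area is `area_eq_signedArea`.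

For the other side, each exterior point lies on exactly one forward tangent ray. Take as coordinates
the normal angle φ of that ray and the angle s = π - ω from φ to the normal of the second tangent.
The Jacobian is the product of two gaps (distances of a contact point from the other tangent line)
divided by sin³ s, so the factor sin³ ω cancels the denominator (`integral_sin_visualAngle`). What
remains is a double integral of a form quadratic in p and p', with value 3/4 L² + 9/4 `power p 2`
(`integral_gapProduct`). The L² terms of the bound then cancel, and the frequencies ±2 drop out of
δ₂², leaving 10 times the sum of `power p n` over |n| ≥ 3 (`hasSum_deficitBound`).

The inequality is now termwise: the weight (n² - 1)(n² - 4)/4 is exactly 10 at n = ±3 and larger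
beyond. Equality therefore means that p has no frequency above 3. The constant is a parallel offset,
frequency 1 a translation, frequency 2 an astroid and frequency 3 a Steiner curve. -/

/-! ### Fourier coefficients of periodic functions and Parseval's identity -/

theorem integral_deriv_mul_of_periodic {f g f' g' : ℝ → ℝ} (hf : ∀ x, HasDerivAt f (f' x) x)
    (hg : ∀ x, HasDerivAt g (g' x) x) (hf' : Continuous f') (hg' : Continuous g')
    (hfp : Function.Periodic f (2 * π)) (hgp : Function.Periodic g (2 * π)) :
    ∫ x in (0 : ℝ)..(2 * π), f' x * g x = -∫ x in (0 : ℝ)..(2 * π), f x * g' x := by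
  have h := intervalIntegral.integral_mul_deriv_eq_deriv_mul (a := 0) (b := 2 * π)
    (fun x _ => hf x) (fun x _ => hg x) (hf'.intervalIntegrable _ _) (hg'.intervalIntegrable _ _)
  have h1 : f (2 * π) = f 0 := by simpa using hfp 0
  have h2 : g (2 * π) = g 0 := by simpa using hgp 0
  rw [h, h1, h2]
  ring

theorem integral_deriv_of_periodic {f f' : ℝ → ℝ} (hf : ∀ x, HasDerivAt f (f' x) x)
    (hf' : Continuous f') (hfp : Function.Periodic f (2 * π)) :
    ∫ x in (0 : ℝ)..(2 * π), f' x = 0 := by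
  have h1 : f (2 * π) = f 0 := by simpa using hfp 0
  rw [intervalIntegral.integral_eq_sub_of_hasDerivAt (fun x _ => hf x)
    (hf'.intervalIntegrable _ _), h1, sub_self]

/-- The cosine coefficient `∫ f(θ) cos(nθ) dθ`. -/
noncomputable def cosCoeff (f : ℝ → ℝ) (n : ℤ) : ℝ := ∫ θ in (0 : ℝ)..(2 * π), f θ * cos (n * θ)

/-- The sine coefficient `∫ f(θ) sin(nθ) dθ`. -/
noncomputable def sinCoeff (f : ℝ → ℝ) (n : ℤ) : ℝ := ∫ θ in (0 : ℝ)..(2 * π), f θ * sin (n * θ)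

/-- The power of the frequency `n`. -/
noncomputable def power (f : ℝ → ℝ) (n : ℤ) : ℝ := cosCoeff f n ^ 2 + sinCoeff f n ^ 2

theorem power_nonneg (f : ℝ → ℝ) (n : ℤ) : 0 ≤ power f n := by unfold power; positivity

theorem cosCoeff_neg (f : ℝ → ℝ) (n : ℤ) : cosCoeff f (-n) = cosCoeff f n := by
  simp [cosCoeff]

theorem sinCoeff_neg (f : ℝ → ℝ) (n : ℤ) : sinCoeff f (-n) = -sinCoeff f n := by
  simp [sinCoeff]

theorem power_neg (f : ℝ → ℝ) (n : ℤ) : power f (-n) = power f n := by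
  simp [power, cosCoeff_neg, sinCoeff_neg]

theorem cosCoeff_zero (f : ℝ → ℝ) : cosCoeff f 0 = ∫ θ in (0 : ℝ)..(2 * π), f θ := by
  simp [cosCoeff]

theorem sinCoeff_zero (f : ℝ → ℝ) : sinCoeff f 0 = 0 := by
  simp [sinCoeff]

theorem power_zero (f : ℝ → ℝ) : power f 0 = (∫ θ in (0 : ℝ)..(2 * π), f θ) ^ 2 := by
  simp [power, cosCoeff_zero, sinCoeff_zero]

/-- Parseval's identity on [0, 2π]. The complex coefficient of index n is (a - ib)/(2π), with a and
b the unnormalised cosine and sine coefficients, so the sum runs over all integers and counts n and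
-n separately. -/
theorem hasSum_power {f : ℝ → ℝ} (hf : Continuous f) :
    HasSum (power f) (2 * π * ∫ θ in (0 : ℝ)..(2 * π), f θ ^ 2) := by
  have hab : (0 : ℝ) < 2 * π := by positivity
  have hmem : MemLp (fun x => (f x : ℂ)) 2 (volume.restrict (Set.Ioc 0 (2 * π))) := by
    have hc : Continuous fun x => (f x : ℂ) := by fun_prop
    obtain ⟨B, hB⟩ := isCompact_Icc.exists_bound_of_continuousOn (s := Set.Icc 0 (2 * π))
      hc.continuousOn
    refine MemLp.of_bound hc.aestronglyMeasurable B ?_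
    filter_upwards [ae_restrict_mem measurableSet_Ioc] with x hx
    exact hB x (Set.Ioc_subset_Icc_self hx)
  have h := (hasSum_sq_fourierCoeffOn hab hmem).mul_left ((2 * π) ^ 2)
  convert! h using 1
  · funext n
    have e : fourierCoeffOn hab (fun x => (f x : ℂ)) n =
        ((1 / (2 * π) : ℝ) : ℂ) * ((cosCoeff f n : ℂ) - (sinCoeff f n : ℂ) * Complex.I) := by
      rw [fourierCoeffOn_eq_integral, cosCoeff, sinCoeff, ← intervalIntegral.integral_ofReal,
        ← intervalIntegral.integral_ofReal, ← intervalIntegral.integral_mul_const,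
        ← intervalIntegral.integral_sub]
      · rw [sub_zero, Complex.real_smul]
        congr 1
        apply intervalIntegral.integral_congr
        intro x _
        beta_reduce
        rw [fourier_coe_apply]
        have : 2 * (π : ℂ) * Complex.I * ((-n : ℤ) : ℂ) * x / ((2 * π : ℝ) : ℂ)
            = ((-(n * x) : ℝ) : ℂ) * Complex.I := by
          push_cast; field_simp
        rw [this, Complex.exp_mul_I, ← Complex.ofReal_cos, ← Complex.ofReal_sin, cos_neg, sin_neg]
        simp only [smul_eq_mul]
        push_cast; ring
      · exact (by fun_prop : Continuous _).intervalIntegrable _ _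
      · exact (by fun_prop : Continuous _).intervalIntegrable _ _
    rw [e, norm_mul, mul_pow ‖_‖ ‖_‖ 2, Complex.norm_real,
      ← Complex.normSq_eq_norm_sq]
    have : Complex.normSq ((cosCoeff f n : ℂ) - (sinCoeff f n : ℂ) * Complex.I) = power f n := by
      simp [Complex.normSq_apply, power]; ring
    rw [this, Real.norm_eq_abs, sq_abs]
    field_simp
  · simp only [Complex.norm_real, Real.norm_eq_abs, sq_abs, sub_zero, smul_eq_mul]
    field_simp

theorem periodic_cos_int_mul (n : ℤ) : Function.Periodic (fun θ : ℝ => cos (n * θ)) (2 * π) := by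
  intro θ
  simp only
  rw [mul_add, cos_add_int_mul_two_pi]

theorem periodic_sin_int_mul (n : ℤ) : Function.Periodic (fun θ : ℝ => sin (n * θ)) (2 * π) := by
  intro θ
  simp only
  rw [mul_add, sin_add_int_mul_two_pi]

theorem hasDerivAt_cos_mul (n θ : ℝ) : HasDerivAt (fun θ : ℝ => cos (n * θ)) (-n * sin (n * θ)) θ := by
  have h := ((hasDerivAt_id θ).const_mul n).cos
  refine h.congr_deriv ?_
  simp only [id_eq]; ring

theorem hasDerivAt_sin_mul (n θ : ℝ) : HasDerivAt (fun θ : ℝ => sin (n * θ)) (n * cos (n * θ)) θ := by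
  have h := ((hasDerivAt_id θ).const_mul n).sin
  refine h.congr_deriv ?_
  simp only [id_eq]; ring

theorem cosCoeff_deriv {f f' : ℝ → ℝ} (hf : ∀ x, HasDerivAt f (f' x) x) (hf' : Continuous f')
    (hfp : Function.Periodic f (2 * π)) (n : ℤ) : cosCoeff f' n = n * sinCoeff f n := by
  rw [cosCoeff, integral_deriv_mul_of_periodic hf (fun x => hasDerivAt_cos_mul n x) hf'
    (by fun_prop) hfp (periodic_cos_int_mul n), sinCoeff, ← intervalIntegral.integral_const_mul,
    ← intervalIntegral.integral_neg]
  congr 1; funext x; ring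

theorem sinCoeff_deriv {f f' : ℝ → ℝ} (hf : ∀ x, HasDerivAt f (f' x) x) (hf' : Continuous f')
    (hfp : Function.Periodic f (2 * π)) (n : ℤ) : sinCoeff f' n = -(n * cosCoeff f n) := by
  rw [sinCoeff, integral_deriv_mul_of_periodic hf (fun x => hasDerivAt_sin_mul n x) hf'
    (by fun_prop) hfp (periodic_sin_int_mul n), cosCoeff, ← intervalIntegral.integral_const_mul]
  congr 2; funext x; ring

theorem power_deriv {f f' : ℝ → ℝ} (hf : ∀ x, HasDerivAt f (f' x) x) (hf' : Continuous f')
    (hfp : Function.Periodic f (2 * π)) (n : ℤ) : power f' n = n ^ 2 * power f n := by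
  rw [power, power, cosCoeff_deriv hf hf' hfp, sinCoeff_deriv hf hf' hfp]; ring

theorem cosCoeff_sub {f g : ℝ → ℝ} (hf : Continuous f) (hg : Continuous g) (n : ℤ) :
    cosCoeff (fun θ => f θ - g θ) n = cosCoeff f n - cosCoeff g n := by
  rw [cosCoeff, cosCoeff, cosCoeff, ← intervalIntegral.integral_sub]
  · congr 1; funext x; ring
  all_goals exact (by fun_prop : Continuous _).intervalIntegrable _ _

theorem sinCoeff_sub {f g : ℝ → ℝ} (hf : Continuous f) (hg : Continuous g) (n : ℤ) :
    sinCoeff (fun θ => f θ - g θ) n = sinCoeff f n - sinCoeff g n := by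
  rw [sinCoeff, sinCoeff, sinCoeff, ← intervalIntegral.integral_sub]
  · congr 1; funext x; ring
  all_goals exact (by fun_prop : Continuous _).intervalIntegrable _ _

/-- The trigonometric monomial `x cos(kθ) + y sin(kθ)`. -/
noncomputable def trigMonomial (k : ℤ) (x y θ : ℝ) : ℝ := x * cos (k * θ) + y * sin (k * θ)

theorem continuous_trigMonomial (k : ℤ) (x y : ℝ) : Continuous (trigMonomial k x y) := by
  unfold trigMonomial; fun_prop

theorem hasDerivAt_trigMonomial (k : ℤ) (x y θ : ℝ) :
    HasDerivAt (trigMonomial k x y) (trigMonomial k (k * y) (-(k * x)) θ) θ := by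
  have h := ((hasDerivAt_cos_mul k θ).const_mul x).add ((hasDerivAt_sin_mul k θ).const_mul y)
  refine h.congr_deriv ?_
  unfold trigMonomial; ring

theorem periodic_trigMonomial (k : ℤ) (x y : ℝ) : Function.Periodic (trigMonomial k x y) (2 * π) := by
  intro θ
  have h1 := periodic_cos_int_mul k θ
  have h2 := periodic_sin_int_mul k θ
  simp only at h1 h2
  rw [trigMonomial, trigMonomial, h1, h2]

/-- Orthogonality by eigenvalues: two derivatives multiply the monomial by -k², while two
integrations by parts multiply its n-th coefficient by -n². Hence (n² - k²) annihilates the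
coefficient. -/
theorem cosCoeff_trigMonomial_of_ne {k n : ℤ} (h : n ^ 2 ≠ k ^ 2) (x y : ℝ) :
    cosCoeff (trigMonomial k x y) n = 0 := by
  have h1 := cosCoeff_deriv (hasDerivAt_trigMonomial k x y) (continuous_trigMonomial _ _ _)
    (periodic_trigMonomial k x y) n
  have h2 := sinCoeff_deriv (hasDerivAt_trigMonomial k (k * y) (-(k * x))) (continuous_trigMonomial _ _ _)
    (periodic_trigMonomial k _ _) n
  have h3 := cosCoeff_deriv (hasDerivAt_trigMonomial k (k * y) (-(k * x))) (continuous_trigMonomial _ _ _)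
    (periodic_trigMonomial k _ _) n
  have h4 := sinCoeff_deriv (hasDerivAt_trigMonomial k x y) (continuous_trigMonomial _ _ _)
    (periodic_trigMonomial k x y) n
  have e : cosCoeff (trigMonomial k (k * -(k * x)) (-(k * (k * y)))) n
      = -(k ^ 2 * cosCoeff (trigMonomial k x y) n) := by
    rw [cosCoeff, cosCoeff, ← intervalIntegral.integral_const_mul, ← intervalIntegral.integral_neg]
    congr 1; funext t; simp only [trigMonomial]; ring
  rw [e, h4] at h3
  have h5 : ((n : ℝ) ^ 2 - k ^ 2) ≠ 0 := by
    rw [sub_ne_zero]; exact_mod_cast h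
  apply (mul_eq_zero.1 (_ : ((n : ℝ) ^ 2 - k ^ 2) * _ = 0)).resolve_left h5
  linear_combination h3

theorem sinCoeff_trigMonomial_of_ne {k n : ℤ} (h : n ^ 2 ≠ k ^ 2) (x y : ℝ) :
    sinCoeff (trigMonomial k x y) n = 0 := by
  by_cases hn : n = 0
  · rw [hn, sinCoeff_zero]
  have h1 := cosCoeff_deriv (hasDerivAt_trigMonomial k x y) (continuous_trigMonomial _ _ _)
    (periodic_trigMonomial k x y) n
  rw [cosCoeff_trigMonomial_of_ne h] at h1
  exact (mul_eq_zero.1 h1.symm).resolve_left (by exact_mod_cast hn)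

theorem integral_cos_int_mul {k : ℤ} (hk : k ≠ 0) :
    ∫ θ in (0 : ℝ)..(2 * π), cos (k * θ) = 0 := by
  have h := cosCoeff_trigMonomial_of_ne (k := k) (n := 0) (by simpa using (pow_ne_zero 2 hk).symm) 1 0
  simpa [cosCoeff_zero, trigMonomial] using h

theorem integral_sin_int_mul (k : ℤ) :
    ∫ θ in (0 : ℝ)..(2 * π), sin (k * θ) = 0 := by
  by_cases hk : k = 0
  · simp [hk]
  have h := cosCoeff_trigMonomial_of_ne (k := k) (n := 0) (by simpa using (pow_ne_zero 2 hk).symm) 0 1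
  simpa [cosCoeff_zero, trigMonomial] using h

theorem cosCoeff_trigMonomial_self {k : ℤ} (hk : k ≠ 0) (x y : ℝ) :
    cosCoeff (trigMonomial k x y) k = π * x := by
  have h2 : (2 * k : ℤ) ≠ 0 := by omega
  have e : ∀ θ : ℝ, trigMonomial k x y θ * cos (k * θ) =
      x / 2 + (x / 2) * cos ((2 * k : ℤ) * θ) + (y / 2) * sin ((2 * k : ℤ) * θ) := by
    intro θ
    push_cast
    rw [mul_assoc 2 (k : ℝ) θ, cos_two_mul, sin_two_mul, trigMonomial]; ring
  rw [cosCoeff]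
  simp only [e]
  rw [intervalIntegral.integral_add, intervalIntegral.integral_add,
    intervalIntegral.integral_const_mul, intervalIntegral.integral_const_mul,
    integral_cos_int_mul h2, integral_sin_int_mul]
  · simp; ring
  all_goals exact (by fun_prop : Continuous _).intervalIntegrable _ _

theorem sinCoeff_trigMonomial_self {k : ℤ} (hk : k ≠ 0) (x y : ℝ) :
    sinCoeff (trigMonomial k x y) k = π * y := by
  have h := cosCoeff_deriv (hasDerivAt_trigMonomial k x y) (continuous_trigMonomial _ _ _)
    (periodic_trigMonomial k x y) k
  rw [cosCoeff_trigMonomial_self hk] at h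
  have hk' : (k : ℝ) ≠ 0 := by exact_mod_cast hk
  apply mul_left_cancel₀ hk'
  rw [← h]; ring

/-- Removal of the frequencies `±k` from `f`. -/
noncomputable def removeFrequency (k : ℤ) (f : ℝ → ℝ) (θ : ℝ) : ℝ :=
  f θ - trigMonomial k (cosCoeff f k / π) (sinCoeff f k / π) θ

theorem continuous_removeFrequency (k : ℤ) {f : ℝ → ℝ} (hf : Continuous f) :
    Continuous (removeFrequency k f) :=
  hf.sub (continuous_trigMonomial _ _ _)

theorem cosCoeff_removeFrequency_of_ne {k n : ℤ} (h : n ^ 2 ≠ k ^ 2) {f : ℝ → ℝ}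
    (hf : Continuous f) : cosCoeff (removeFrequency k f) n = cosCoeff f n := by
  unfold removeFrequency
  rw [cosCoeff_sub hf (continuous_trigMonomial _ _ _), cosCoeff_trigMonomial_of_ne h, sub_zero]

theorem sinCoeff_removeFrequency_of_ne {k n : ℤ} (h : n ^ 2 ≠ k ^ 2) {f : ℝ → ℝ}
    (hf : Continuous f) : sinCoeff (removeFrequency k f) n = sinCoeff f n := by
  unfold removeFrequency
  rw [sinCoeff_sub hf (continuous_trigMonomial _ _ _), sinCoeff_trigMonomial_of_ne h, sub_zero]

theorem power_removeFrequency_of_ne {k n : ℤ} (h : n ^ 2 ≠ k ^ 2) {f : ℝ → ℝ}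
    (hf : Continuous f) : power (removeFrequency k f) n = power f n := by
  rw [power, cosCoeff_removeFrequency_of_ne h hf, sinCoeff_removeFrequency_of_ne h hf, power]

/-- The normalisation 1/π is right only for nonzero frequencies, which is why the mean has its own
operation `removeMean`. -/
theorem power_removeFrequency_self {k : ℤ} (hk : k ≠ 0) {f : ℝ → ℝ} (hf : Continuous f) :
    power (removeFrequency k f) k = 0 := by
  unfold removeFrequency
  rw [power, cosCoeff_sub hf (continuous_trigMonomial _ _ _), cosCoeff_trigMonomial_self hk,
    sinCoeff_sub hf (continuous_trigMonomial _ _ _), sinCoeff_trigMonomial_self hk]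
  field_simp
  ring

theorem power_removeFrequency {k : ℤ} (hk : k ≠ 0) {f : ℝ → ℝ} (hf : Continuous f) (n : ℤ) :
    power (removeFrequency k f) n = if n = k ∨ n = -k then 0 else power f n := by
  split_ifs with h
  · rcases h with rfl | rfl
    · exact power_removeFrequency_self hk hf
    · rw [power_neg]; exact power_removeFrequency_self hk hf
  · exact power_removeFrequency_of_ne (by rwa [ne_eq, sq_eq_sq_iff_eq_or_eq_neg]) hf

theorem cosCoeff_const (c : ℝ) {n : ℤ} (hn : n ≠ 0) :
    cosCoeff (fun _ => c) n = 0 := by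
  rw [cosCoeff, intervalIntegral.integral_const_mul, integral_cos_int_mul hn, mul_zero]

/-- `f` minus its mean. -/
noncomputable def removeMean (f : ℝ → ℝ) (θ : ℝ) : ℝ :=
  f θ - (∫ θ in (0 : ℝ)..(2 * π), f θ) / (2 * π)

theorem continuous_removeMean {f : ℝ → ℝ} (hf : Continuous f) : Continuous (removeMean f) :=
  hf.sub continuous_const

theorem cosCoeff_removeMean {f : ℝ → ℝ} (hf : Continuous f) {n : ℤ} (hn : n ≠ 0) :
    cosCoeff (removeMean f) n = cosCoeff f n := by
  unfold removeMean
  rw [cosCoeff_sub hf continuous_const, cosCoeff_const _ hn, sub_zero]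

theorem sinCoeff_removeMean {f : ℝ → ℝ} (hf : Continuous f) (n : ℤ) :
    sinCoeff (removeMean f) n = sinCoeff f n := by
  unfold removeMean
  rw [sinCoeff_sub hf continuous_const, sub_eq_self, sinCoeff,
    intervalIntegral.integral_const_mul, integral_sin_int_mul, mul_zero]

theorem power_removeMean {f : ℝ → ℝ} (hf : Continuous f) (n : ℤ) :
    power (removeMean f) n = if n = 0 then 0 else power f n := by
  split_ifs with h
  · rw [h, power_zero]
    unfold removeMean
    rw [intervalIntegral.integral_sub (hf.intervalIntegrable _ _)
      (continuous_const.intervalIntegrable _ _)]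
    simp
  · rw [power, cosCoeff_removeMean hf h, sinCoeff_removeMean hf, power]

/-- Parseval gives ∫ f² = 0, and a continuous function that is nonzero somewhere in a period has a
positive square integral. -/
theorem eq_zero_of_power_eq_zero {f : ℝ → ℝ} (hf : Continuous f)
    (hfp : Function.Periodic f (2 * π)) (h : ∀ n, power f n = 0) (θ : ℝ) : f θ = 0 := by
  have h0 : 2 * π * ∫ θ in (0 : ℝ)..(2 * π), f θ ^ 2 = 0 := by
    refine (hasSum_power hf).unique ?_
    rw [funext h]
    exact hasSum_zero
  have h1 : ∫ θ in (0 : ℝ)..(2 * π), f θ ^ 2 = 0 :=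
    (mul_eq_zero.1 h0).resolve_left (by positivity)
  obtain ⟨y, hy, hxy⟩ := hfp.exists_mem_Ico₀ (by positivity) θ
  rw [hxy]
  by_contra hne
  have hpos : 0 < ∫ θ in (0 : ℝ)..(2 * π), f θ ^ 2 :=
    intervalIntegral.integral_pos (by positivity) (by fun_prop) (fun x _ => sq_nonneg _)
      ⟨y, Set.Ico_subset_Icc_self hy, by positivity⟩
  exact hpos.ne' h1

/-! ### Derivatives of periodic `C²` functions -/

theorem hasDerivAt_of_contDiff_two {p : ℝ → ℝ} (hp : ContDiff ℝ 2 p) (x : ℝ) :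
    HasDerivAt p (deriv p x) x :=
  (hp.differentiable (by norm_num) x).hasDerivAt

theorem contDiff_deriv_of_contDiff_two {p : ℝ → ℝ} (hp : ContDiff ℝ 2 p) :
    ContDiff ℝ 1 (deriv p) :=
  ((contDiff_succ_iff_deriv (n := 1)).1 (by rw [one_add_one_eq_two]; exact hp)).2.2

theorem hasDerivAt_deriv_of_contDiff_two {p : ℝ → ℝ} (hp : ContDiff ℝ 2 p) (x : ℝ) :
    HasDerivAt (deriv p) (deriv (deriv p) x) x :=
  ((contDiff_deriv_of_contDiff_two hp).differentiable (by norm_num) x).hasDerivAt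

theorem continuous_deriv_of_contDiff_two {p : ℝ → ℝ} (hp : ContDiff ℝ 2 p) :
    Continuous (deriv p) :=
  (contDiff_deriv_of_contDiff_two hp).continuous

theorem continuous_deriv_deriv_of_contDiff_two {p : ℝ → ℝ} (hp : ContDiff ℝ 2 p) :
    Continuous (deriv (deriv p)) :=
  (contDiff_deriv_of_contDiff_two hp).continuous_deriv (by norm_num)

theorem periodic_deriv {p : ℝ → ℝ} {c : ℝ} (hper : Function.Periodic p c) :
    Function.Periodic (deriv p) c := by
  intro x
  have : (fun x => p (x + c)) = p := funext hper
  have h2 := deriv_comp_add_const p c x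
  rw [this] at h2
  exact h2.symm

/-! ### Support functions -/

theorem inner_normalVec (x : Plane) (φ : ℝ) : ⟪x, normalVec φ⟫ = x 0 * cos φ + x 1 * sin φ := by
  simp [normalVec, PiLp.inner_apply, mul_comm]

theorem inner_tangentVec (x : Plane) (φ : ℝ) : ⟪x, tangentVec φ⟫ = -(x 0 * sin φ) + x 1 * cos φ := by
  simp [tangentVec, PiLp.inner_apply, mul_comm]

theorem continuous_inner_normalVec (φ : ℝ) : Continuous fun x : Plane => ⟪x, normalVec φ⟫ := by
  fun_prop

theorem hasDerivAt_inner_normalVec (x : Plane) (φ : ℝ) :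
    HasDerivAt (fun φ => ⟪x, normalVec φ⟫) ⟪x, tangentVec φ⟫ φ := by
  simp only [inner_normalVec, inner_tangentVec]
  have h := ((hasDerivAt_cos φ).const_mul (x 0)).add ((hasDerivAt_sin φ).const_mul (x 1))
  exact h.congr_deriv (by ring)

theorem inner_le_supportFn {K : Set Plane} (hcomp : IsCompact K) {x : Plane} (hx : x ∈ K) (φ : ℝ) :
    ⟪x, normalVec φ⟫ ≤ supportFn K φ :=
  le_csSup (hcomp.image (continuous_inner_normalVec φ)).bddAbove ⟨x, hx, rfl⟩

theorem exists_inner_eq_supportFn {K : Set Plane} (hne : K.Nonempty) (hcomp : IsCompact K) (φ : ℝ) :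
    ∃ x ∈ K, ⟪x, normalVec φ⟫ = supportFn K φ :=
  (hcomp.image (continuous_inner_normalVec φ)).sSup_mem (hne.image _)

theorem normalVec_add_two_pi (φ : ℝ) : normalVec (φ + 2 * π) = normalVec φ := by
  simp [normalVec]

theorem periodic_supportFn (K : Set Plane) : Function.Periodic (supportFn K) (2 * π) := by
  intro φ
  simp only [supportFn, normalVec_add_two_pi]

theorem exists_eq_smul_normalVec (v : Plane) : ∃ r φ : ℝ, 0 ≤ r ∧ v = r • normalVec φ := by
  refine ⟨‖(⟨v 0, v 1⟩ : ℂ)‖, Complex.arg ⟨v 0, v 1⟩, norm_nonneg _, ?_⟩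
  have h1 := Complex.norm_mul_cos_arg ⟨v 0, v 1⟩
  have h2 := Complex.norm_mul_sin_arg ⟨v 0, v 1⟩
  ext i
  fin_cases i
  · simp [normalVec, h1]
  · simp [normalVec, h2]

/-- Hahn–Banach separates an outside point by a functional; its representing vector is r N(φ) with r
≥ 0, and the direction φ then witnesses the violation. -/
theorem mem_iff_inner_le_supportFn {K : Set Plane} (hne : K.Nonempty) (hcomp : IsCompact K)
    (hconv : Convex ℝ K) (x : Plane) : x ∈ K ↔ ∀ φ, ⟪x, normalVec φ⟫ ≤ supportFn K φ := by
  refine ⟨fun hx φ => inner_le_supportFn hcomp hx φ, fun h => ?_⟩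
  by_contra hx
  obtain ⟨f, u, hf, hu⟩ := geometric_hahn_banach_closed_point hconv hcomp.isClosed hx
  obtain ⟨r, φ, hr, hv⟩ := exists_eq_smul_normalVec ((InnerProductSpace.toDual ℝ Plane).symm f)
  have hfv : ∀ y, f y = r * ⟪y, normalVec φ⟫ := by
    intro y
    rw [← InnerProductSpace.toDual_symm_apply, hv, inner_smul_left, real_inner_comm]
    rfl
  obtain ⟨y, hy, hyφ⟩ := exists_inner_eq_supportFn hne hcomp φ
  have h1 := hf y hy
  rw [hfv, hyφ] at h1
  rw [hfv] at hu
  have h2 := mul_le_mul_of_nonneg_left (h φ) hr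
  linarith

/-- The function ψ ↦ p(ψ) - ⟨x, N(ψ)⟩ is nonnegative and vanishes at φ, so its derivative vanishes
there. Contact points are thereby unique and lie on the envelope. -/
theorem inner_tangentVec_eq_deriv {K : Set Plane} (hcomp : IsCompact K) {φ : ℝ}
    (hd : DifferentiableAt ℝ (supportFn K) φ) {x : Plane} (hx : x ∈ K)
    (h : ⟪x, normalVec φ⟫ = supportFn K φ) : ⟪x, tangentVec φ⟫ = deriv (supportFn K) φ := by
  have h1 := hd.hasDerivAt.sub (hasDerivAt_inner_normalVec x φ)
  have hmin : IsLocalMin (supportFn K - fun φ => ⟪x, normalVec φ⟫) φ := by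
    refine Filter.Eventually.of_forall fun ψ => ?_
    have := inner_le_supportFn hcomp hx ψ
    simp only [Pi.sub_apply]
    linarith
  have := hmin.hasDerivAt_eq_zero h1
  linarith

theorem eq_inner_smul_add (x : Plane) (φ : ℝ) :
    x = ⟪x, normalVec φ⟫ • normalVec φ + ⟪x, tangentVec φ⟫ • tangentVec φ := by
  have hs := sin_sq_add_cos_sq φ
  rw [inner_normalVec, inner_tangentVec]
  ext i
  fin_cases i
  · simp [normalVec, tangentVec]
    linear_combination (-x 0) * hs
  · simp [normalVec, tangentVec]
    linear_combination (-x 1) * hs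

theorem eq_boundaryCurve {K : Set Plane} (hcomp : IsCompact K) {φ : ℝ}
    (hd : DifferentiableAt ℝ (supportFn K) φ) {x : Plane} (hx : x ∈ K)
    (h : ⟪x, normalVec φ⟫ = supportFn K φ) : x = boundaryCurve K φ := by
  rw [boundaryCurve, envelope, ← inner_tangentVec_eq_deriv hcomp hd hx h, ← h]
  exact eq_inner_smul_add x φ

theorem boundaryCurve_mem {K : Set Plane} (hne : K.Nonempty) (hcomp : IsCompact K) {φ : ℝ}
    (hd : DifferentiableAt ℝ (supportFn K) φ) : boundaryCurve K φ ∈ K := by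
  obtain ⟨x, hx, h⟩ := exists_inner_eq_supportFn hne hcomp φ
  rwa [← eq_boundaryCurve hcomp hd hx h]

/-! ### Tangent rays -/

/-- The distance from the envelope point `φ` to the support line with normal angle `φ + s`. -/
noncomputable def gap (p : ℝ → ℝ) (φ s : ℝ) : ℝ := p (φ + s) - p φ * cos s - deriv p φ * sin s

/-- The point at signed distance `t` from the envelope point on the tangent line with normal
angle `φ`. -/
noncomputable def tangentPoint (p : ℝ → ℝ) (φ t : ℝ) : Plane := envelope p φ + t • tangentVec φ

theorem tangentPoint_apply_zero (p : ℝ → ℝ) (φ t : ℝ) :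
    tangentPoint p φ t 0 = p φ * cos φ - (deriv p φ + t) * sin φ := by
  simp [tangentPoint, envelope, normalVec, tangentVec]; ring

theorem tangentPoint_apply_one (p : ℝ → ℝ) (φ t : ℝ) :
    tangentPoint p φ t 1 = p φ * sin φ + (deriv p φ + t) * cos φ := by
  simp [tangentPoint, envelope, normalVec, tangentVec]; ring

/-- The basic identity of the tangent coordinates: the signed distance to another support line is
affine in t. All later sign and injectivity arguments are read off from it. -/
theorem sub_inner_tangentPoint (p : ℝ → ℝ) (φ t s : ℝ) :
    p (φ + s) - ⟪tangentPoint p φ t, normalVec (φ + s)⟫ = gap p φ s - t * sin s := by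
  have hs := sin_sq_add_cos_sq φ
  rw [inner_normalVec, tangentPoint_apply_zero, tangentPoint_apply_one, gap, cos_add, sin_add]
  linear_combination (-p φ * cos s - (deriv p φ + t) * sin s) * hs

theorem inner_tangentPoint (p : ℝ → ℝ) (φ t : ℝ) :
    ⟪tangentPoint p φ t, normalVec φ⟫ = p φ := by
  have h := sub_inner_tangentPoint p φ t 0
  simp [gap] at h
  linarith

theorem eq_tangentPoint (p : ℝ → ℝ) {φ : ℝ} {P : Plane} (h : ⟪P, normalVec φ⟫ = p φ) :
    P = tangentPoint p φ (⟪P, tangentVec φ⟫ - deriv p φ) := by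
  conv_lhs => rw [eq_inner_smul_add P φ]
  rw [tangentPoint, envelope, h, sub_smul]
  abel

theorem tangentPoint_zero (p : ℝ → ℝ) (φ : ℝ) : tangentPoint p φ 0 = envelope p φ := by
  simp [tangentPoint]

theorem gap_add_two_pi {p : ℝ → ℝ} (hper : Function.Periodic p (2 * π)) (φ s : ℝ) :
    gap p φ (s + 2 * π) = gap p φ s := by
  rw [gap, gap, ← add_assoc, hper, cos_add_two_pi, sin_add_two_pi]

theorem gap_add_two_pi_left {p : ℝ → ℝ} (hper : Function.Periodic p (2 * π)) (φ s : ℝ) :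
    gap p (φ + 2 * π) s = gap p φ s := by
  rw [gap, gap, add_right_comm, hper, hper, periodic_deriv hper]

theorem hasDerivAt_gap {p : ℝ → ℝ} (hp : ContDiff ℝ 2 p) (φ s : ℝ) :
    HasDerivAt (gap p φ) (deriv p (φ + s) + p φ * sin s - deriv p φ * cos s) s := by
  have h := (((hasDerivAt_of_contDiff_two hp (φ + s)).comp_const_add φ s).sub
    ((hasDerivAt_cos s).const_mul (p φ))).sub ((hasDerivAt_sin s).const_mul (deriv p φ))
  exact h.congr_deriv (by ring)

/-- As a function of s, the gap g solves g'' + g = ρ(φ + s) with zero initial data, where ρ = p +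
p''. This is variation of constants in differential form: g' sin(s - u) + g cos(s - u) goes from 0
at u = 0 to g(s) at u = s, with derivative ρ sin(s - u). -/
theorem hasDerivAt_gap_sturm {p : ℝ → ℝ} (hp : ContDiff ℝ 2 p) (φ s u : ℝ) :
    HasDerivAt (fun u => (deriv p (φ + u) + p φ * sin u - deriv p φ * cos u) * sin (s - u)
      + gap p φ u * cos (s - u))
      ((p (φ + u) + deriv (deriv p) (φ + u)) * sin (s - u)) u := by
  have h1 := (((hasDerivAt_deriv_of_contDiff_two hp (φ + u)).comp_const_add φ u).add
    ((hasDerivAt_sin u).const_mul (p φ))).sub ((hasDerivAt_cos u).const_mul (deriv p φ))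
  have hid : HasDerivAt (fun u => s - u) (-1) u := (hasDerivAt_id u).const_sub s
  have h := (h1.mul hid.sin).add ((hasDerivAt_gap hp φ u).mul hid.cos)
  refine h.congr_deriv ?_
  simp only [gap, Pi.add_apply, Pi.sub_apply]
  ring

theorem gap_pos_of_le_pi {p : ℝ → ℝ} (hp : ContDiff ℝ 2 p)
    (hpos : ∀ φ, 0 < p φ + deriv (deriv p) φ) (φ : ℝ) {s : ℝ} (hs0 : 0 < s) (hs : s ≤ π) :
    0 < gap p φ s := by
  have hmono := strictMonoOn_of_deriv_pos (convex_Icc 0 s)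
    (f := fun u => (deriv p (φ + u) + p φ * sin u - deriv p φ * cos u) * sin (s - u)
      + gap p φ u * cos (s - u))
    (fun u _ => (hasDerivAt_gap_sturm hp φ s u).continuousAt.continuousWithinAt) (by
      intro u hu
      rw [interior_Icc] at hu
      rw [(hasDerivAt_gap_sturm hp φ s u).deriv]
      exact mul_pos (hpos _) (sin_pos_of_pos_of_lt_pi (by linarith [hu.2]) (by linarith [hu.1])))
  have h := hmono (Set.left_mem_Icc.2 hs0.le) (Set.right_mem_Icc.2 hs0.le) hs0
  simpa [gap] using h

theorem gap_pos_of_neg {p : ℝ → ℝ} (hp : ContDiff ℝ 2 p)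
    (hpos : ∀ φ, 0 < p φ + deriv (deriv p) φ) (φ : ℝ) {s : ℝ} (hs0 : s < 0) (hs : -π ≤ s) :
    0 < gap p φ s := by
  have hmono := strictAntiOn_of_deriv_neg (convex_Icc s 0)
    (f := fun u => (deriv p (φ + u) + p φ * sin u - deriv p φ * cos u) * sin (s - u)
      + gap p φ u * cos (s - u))
    (fun u _ => (hasDerivAt_gap_sturm hp φ s u).continuousAt.continuousWithinAt) (by
      intro u hu
      rw [interior_Icc] at hu
      rw [(hasDerivAt_gap_sturm hp φ s u).deriv]
      exact mul_neg_of_pos_of_neg (hpos _)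
        (sin_neg_of_neg_of_neg_pi_lt (by linarith [hu.1]) (by linarith [hu.2])))
  have h := hmono (Set.left_mem_Icc.2 hs0.le) (Set.right_mem_Icc.2 hs0.le) hs0
  simpa [gap] using h

theorem gap_pos {p : ℝ → ℝ} (hp : ContDiff ℝ 2 p) (hper : Function.Periodic p (2 * π))
    (hpos : ∀ φ, 0 < p φ + deriv (deriv p) φ) (φ : ℝ) {s : ℝ} (hs0 : 0 < s) (hs : s < 2 * π) :
    0 < gap p φ s := by
  rcases le_total s π with h | h
  · exact gap_pos_of_le_pi hp hpos φ hs0 h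
  · have := gap_pos_of_neg hp hpos φ (s := s - 2 * π) (by linarith) (by linarith)
    rw [← gap_add_two_pi hper] at this
    simpa using this

/-- The length of the tangent segment from the intersection of the support lines with normal angles
`φ` and `φ + s` to the envelope point `φ`. -/
noncomputable def tangentLength (p : ℝ → ℝ) (φ s : ℝ) : ℝ := gap p φ s / sin s

theorem tangentLength_pos {p : ℝ → ℝ} (hp : ContDiff ℝ 2 p)
    (hpos : ∀ φ, 0 < p φ + deriv (deriv p) φ) (φ : ℝ) {s : ℝ} (hs0 : 0 < s) (hs : s < π) :
    0 < tangentLength p φ s :=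
  div_pos (gap_pos_of_le_pi hp hpos φ hs0 hs.le) (sin_pos_of_pos_of_lt_pi hs0 hs)

theorem gap_neg_pos {p : ℝ → ℝ} (hp : ContDiff ℝ 2 p)
    (hpos : ∀ φ, 0 < p φ + deriv (deriv p) φ) (φ : ℝ) {s : ℝ} (hs0 : 0 < s) (hs : s < π) :
    0 < gap p (φ + s) (-s) :=
  gap_pos_of_neg hp hpos _ (by linarith) (by linarith)

/-- The numerator g' sin s - g cos s of the quotient rule is the gap seen from the other tangent.
Its positivity makes the tangent length increase with the turning angle, and it supplies the second
factor of the Jacobian. -/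
theorem hasDerivAt_tangentLength {p : ℝ → ℝ} (hp : ContDiff ℝ 2 p) (φ : ℝ) {s : ℝ}
    (hs : sin s ≠ 0) :
    HasDerivAt (tangentLength p φ) (gap p (φ + s) (-s) / sin s ^ 2) s := by
  have h := (hasDerivAt_gap hp φ s).div (hasDerivAt_sin s) hs
  refine h.congr_deriv ?_
  congr 1
  have := sin_sq_add_cos_sq s
  simp only [gap, sin_neg, cos_neg, add_neg_cancel_right]
  linear_combination (p φ) * this

theorem strictMonoOn_tangentLength {p : ℝ → ℝ} (hp : ContDiff ℝ 2 p)
    (hpos : ∀ φ, 0 < p φ + deriv (deriv p) φ) (φ : ℝ) :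
    StrictMonoOn (tangentLength p φ) (Set.Ioo 0 π) := by
  have hsin : ∀ s ∈ Set.Ioo 0 π, 0 < sin s := fun s hs => sin_pos_of_pos_of_lt_pi hs.1 hs.2
  refine strictMonoOn_of_deriv_pos (convex_Ioo 0 π)
    (fun s hs => (hasDerivAt_tangentLength hp φ (hsin s hs).ne').continuousAt.continuousWithinAt) ?_
  intro s hs
  rw [interior_Ioo] at hs
  rw [(hasDerivAt_tangentLength hp φ (hsin s hs).ne').deriv]
  have := gap_neg_pos hp hpos φ hs.1 hs.2
  have := hsin s hs
  positivity

/-- Every positive length is a tangent length. -/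
theorem exists_tangentLength_eq {p : ℝ → ℝ} (hp : ContDiff ℝ 2 p)
    (hpos : ∀ φ, 0 < p φ + deriv (deriv p) φ) (φ : ℝ) {t : ℝ} (ht : 0 < t) :
    ∃ s ∈ Set.Ioo 0 π, tangentLength p φ s = t := by
  have hcont : Continuous (fun s => gap p φ s - t * sin s) := by
    have : Continuous (gap p φ) :=
      continuous_iff_continuousAt.2 fun s => (hasDerivAt_gap hp φ s).continuousAt
    fun_prop
  have hπ : 0 < gap p φ π - t * sin π := by
    rw [sin_pi, mul_zero, sub_zero]
    exact gap_pos_of_le_pi hp hpos φ pi_pos le_rfl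
  -- The gap vanishes to second order at 0, so gap - t sin s has slope -t there and dips below zero
  -- before reaching its positive value at π.
  have h0 : ∃ s ∈ Set.Ioo 0 π, gap p φ s - t * sin s < 0 := by
    have hd : HasDerivAt (fun s => gap p φ s - t * sin s) (-t) 0 := by
      refine ((hasDerivAt_gap hp φ 0).sub ((hasDerivAt_sin 0).const_mul t)).congr_deriv ?_
      simp
    have hlt := (hasDerivAt_iff_tendsto_slope.1 hd).eventually (eventually_lt_nhds (neg_lt_zero.2 ht))
    have hlt' : ∀ᶠ s in nhdsWithin 0 (Set.Ioi 0),
        slope (fun s => gap p φ s - t * sin s) 0 s < 0 :=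
      hlt.filter_mono (nhdsWithin_mono _ (show Set.Ioi (0 : ℝ) ⊆ {0}ᶜ from
        fun s hs => Set.mem_compl_singleton_iff.2 (ne_of_gt hs)))
    obtain ⟨s, hs, hsπ⟩ := (hlt'.and (Ioo_mem_nhdsGT pi_pos)).exists
    refine ⟨s, hsπ, ?_⟩
    rw [slope_def_field] at hs
    have hs0 : 0 < s := hsπ.1
    rw [div_neg_iff] at hs
    have hz : gap p φ 0 - t * sin 0 = 0 := by simp [gap]
    rw [hz] at hs
    rcases hs with hs | hs
    · linarith [hs.2]
    · linarith [hs.1]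
  obtain ⟨a, ha, hneg⟩ := h0
  obtain ⟨s, hs, hsz⟩ := intermediate_value_Icc ha.2.le hcont.continuousOn ⟨hneg.le, hπ.le⟩
  simp only at hsz
  have hsπ : s ≠ π := by rintro rfl; exact hπ.ne' hsz
  have hs' : s ∈ Set.Ioo 0 π := ⟨ha.1.trans_le hs.1, lt_of_le_of_ne hs.2 hsπ⟩
  refine ⟨s, hs', ?_⟩
  have := sin_pos_of_pos_of_lt_pi hs'.1 hs'.2
  rw [tangentLength, div_eq_iff this.ne']
  linarith

/-! ### The exterior of a convex set is swept by tangent rays -/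

theorem exists_inner_gt_of_notMem {K : Set Plane} (hne : K.Nonempty) (hcomp : IsCompact K)
    (hconv : Convex ℝ K) {P : Plane} (hP : P ∉ K) :
    ∃ φ, supportFn K φ < ⟪P, normalVec φ⟫ := by
  rw [mem_iff_inner_le_supportFn hne hcomp hconv] at hP
  push Not at hP
  exact hP

theorem normalVec_add_pi (φ : ℝ) : normalVec (φ + π) = -normalVec φ := by
  ext i
  fin_cases i <;> simp [normalVec]

theorem tangentPoint_notMem {K : Set Plane} (hcomp : IsCompact K)
    (hsmooth : ContDiff ℝ 2 (supportFn K)) (φ : ℝ) {t : ℝ} (ht : 0 < t) :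
    tangentPoint (supportFn K) φ t ∉ K := by
  intro h
  have h1 := inner_tangentVec_eq_deriv hcomp
    (hasDerivAt_of_contDiff_two hsmooth φ).differentiableAt h (inner_tangentPoint _ _ _)
  rw [inner_tangentVec, tangentPoint_apply_zero, tangentPoint_apply_one] at h1
  have hs := sin_sq_add_cos_sq φ
  have : t = 0 := by
    linear_combination h1 - (deriv (supportFn K) φ + t) * hs
  linarith

/-- The point lies beyond some support line and strictly inside the opposite one, so a support line
through it occurs in the half turn between them. Searching the half turn before ψ, not after it,
selects the tangent on which the point lies on the forward ray. -/
theorem exists_tangentPoint_eq {K : Set Plane} (hne : K.Nonempty) (hcomp : IsCompact K)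
    (hconv : Convex ℝ K) (hsmooth : ContDiff ℝ 2 (supportFn K))
    (hcurv : ∀ φ, 0 < supportFn K φ + deriv (deriv (supportFn K)) φ) {P : Plane} (hP : P ∉ K) :
    ∃ φ ∈ Set.Ioc 0 (2 * π), ∃ t, 0 < t ∧ tangentPoint (supportFn K) φ t = P := by
  set p := supportFn K with hp
  obtain ⟨ψ, hψ⟩ := exists_inner_gt_of_notMem hne hcomp hconv hP
  rw [← hp] at hψ
  have hψ' : ⟪P, normalVec (ψ - π)⟫ < p (ψ - π) := by
    obtain ⟨x, hx⟩ := hne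
    have h1 := inner_le_supportFn hcomp hx ψ
    have h2 := inner_le_supportFn hcomp hx (ψ - π)
    have h3 : normalVec (ψ - π) = -normalVec ψ := by
      rw [← neg_eq_iff_eq_neg, ← normalVec_add_pi, sub_add_cancel]
    rw [h3, inner_neg_right] at h2 ⊢
    rw [hp]
    linarith
  have hcont : Continuous fun φ => p φ - ⟪P, normalVec φ⟫ :=
    continuous_iff_continuousAt.2 fun φ =>
      ((hasDerivAt_of_contDiff_two hsmooth φ).sub (hasDerivAt_inner_normalVec P φ)).continuousAt
  obtain ⟨a, ha, hz⟩ := intermediate_value_Icc' (show ψ - π ≤ ψ by linarith [pi_pos])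
    hcont.continuousOn (show (0 : ℝ) ∈ Set.Icc (p ψ - ⟪P, normalVec ψ⟫)
      (p (ψ - π) - ⟪P, normalVec (ψ - π)⟫) from ⟨by linarith, by linarith⟩)
  simp only at hz
  have ha1 : a ≠ ψ := by rintro rfl; linarith
  have ha2 : a ≠ ψ - π := by rintro rfl; linarith
  have hz' : ⟪P, normalVec a⟫ = p a := by linarith
  have hs0 : 0 < ψ - a := by
    have := lt_of_le_of_ne ha.2 ha1
    linarith
  have hsπ : ψ - a < π := by
    have := lt_of_le_of_ne ha.1 ha2.symm
    linarith
  have hPa := eq_tangentPoint p hz'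
  set t := ⟪P, tangentVec a⟫ - deriv p a with ht
  -- At angle ψ the point is outside, so gap - t sin(ψ - a) is negative while the gap and the sine
  -- are positive.
  have ht0 : 0 < t := by
    have h1 := sub_inner_tangentPoint p a t (ψ - a)
    rw [← hPa, add_sub_cancel] at h1
    have h2 := gap_pos_of_le_pi hsmooth hcurv a hs0 hsπ.le
    have h3 := sin_pos_of_pos_of_lt_pi hs0 hsπ
    by_contra hle
    have := mul_nonneg (sub_nonneg.2 (not_lt.1 hle)) h3.le
    linarith
  have hper : Function.Periodic (fun φ => tangentPoint p φ t) (2 * π) := by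
    intro φ
    ext i
    have h1 := periodic_supportFn K φ
    have h2 := periodic_deriv (periodic_supportFn K) φ
    rw [← hp] at h1 h2
    fin_cases i
    · simp [tangentPoint_apply_zero, h1, h2]
    · simp [tangentPoint_apply_one, h1, h2]
  obtain ⟨b, hb, hab⟩ := hper.exists_mem_Ioc (by positivity) a 0
  simp only [zero_add] at hb
  exact ⟨b, hb, t, ht0, by rw [hPa]; exact hab.symm⟩

/-- If a forward ray point of the line a lies also on the line b, then the positive gap equals t
sin(b - a), so this sine is positive. When both rays are forward, the roles can be exchanged, and
the sine would have both signs. -/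
theorem tangentPoint_injective {p : ℝ → ℝ} (hp : ContDiff ℝ 2 p)
    (hper : Function.Periodic p (2 * π)) (hpos : ∀ φ, 0 < p φ + deriv (deriv p) φ)
    {a b t u : ℝ} (ha : a ∈ Set.Ioc 0 (2 * π)) (hb : b ∈ Set.Ioc 0 (2 * π)) (ht : 0 < t)
    (hu : 0 < u) (h : tangentPoint p a t = tangentPoint p b u) : a = b ∧ t = u := by
  have key : ∀ {a b t : ℝ}, a < b → b < a + 2 * π → 
      ⟪tangentPoint p a t, normalVec b⟫ = p b → 0 < t * sin (b - a) := by
    intro a b t hab hba h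
    have h1 := sub_inner_tangentPoint p a t (b - a)
    rw [add_sub_cancel, h] at h1
    have h2 := gap_pos hp hper hpos a (s := b - a) (by linarith) (by linarith)
    linarith
  have key2 : ∀ {a b t u : ℝ}, a ∈ Set.Ioc 0 (2 * π) → b ∈ Set.Ioc 0 (2 * π) → 0 < t → 0 < u →
      tangentPoint p a t = tangentPoint p b u → ¬ a < b := by
    intro a b t u ha hb ht hu h hlt
    have h1 := key (t := t) hlt (by linarith [ha.1, hb.2]) (by rw [h, inner_tangentPoint])
    have h2 := key (a := b) (b := a + 2 * π) (t := u) (by linarith [ha.1, hb.2]) (by linarith)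
      (by rw [← h, normalVec_add_two_pi, inner_tangentPoint, hper])
    have h3 : sin (a + 2 * π - b) = -sin (b - a) := by
      rw [← sin_neg, ← sin_add_two_pi (-(b - a))]; congr 1; ring
    rw [h3] at h2
    have h4 := pos_of_mul_pos_right h1 ht.le
    have h5 := pos_of_mul_pos_right h2 hu.le
    linarith
  have hab : a = b := le_antisymm (not_lt.1 (key2 hb ha hu ht h.symm)) (not_lt.1 (key2 ha hb ht hu h))
  subst hab
  refine ⟨rfl, ?_⟩
  have h1 := congrArg (fun x : Plane => ⟪x, tangentVec a⟫) h
  simp only [inner_tangentVec, tangentPoint_apply_zero, tangentPoint_apply_one] at h1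
  have hs := sin_sq_add_cos_sq a
  linear_combination h1 + (u - t) * hs

/-! ### Change of variables -/

/-- The identification of `ℝ × ℝ` with the plane. -/
noncomputable def planeEquiv : (ℝ × ℝ) ≃ᵐ Plane :=
  MeasurableEquiv.finTwoArrow.symm.trans (MeasurableEquiv.toLp 2 (Fin 2 → ℝ))

theorem measurePreserving_planeEquiv : MeasurePreserving planeEquiv volume volume :=
  (PiLp.volume_preserving_toLp (Fin 2)).comp ((volume_preserving_finTwoArrow ℝ).symm _)

theorem planeEquiv_apply (x : ℝ × ℝ) : planeEquiv x = !₂[x.1, x.2] := rfl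

theorem integrableOn_planeEquiv_image_iff {s : Set (ℝ × ℝ)} (hs : MeasurableSet s)
    {f : ℝ × ℝ → ℝ × ℝ} {f' : ℝ × ℝ → ℝ × ℝ →L[ℝ] ℝ × ℝ}
    (hf' : ∀ x ∈ s, HasFDerivWithinAt f (f' x) s x) (hf : Set.InjOn f s) (g : Plane → ℝ) :
    IntegrableOn g ((fun x => planeEquiv (f x)) '' s) volume ↔
      IntegrableOn (fun x => |(f' x).det| * g (planeEquiv (f x))) s volume := by
  have h1 := integrableOn_image_iff_integrableOn_abs_det_fderiv_smul volume hs hf' hf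
    (fun x => g (planeEquiv x))
  simp only [smul_eq_mul] at h1
  rw [← h1, ← Set.image_image planeEquiv f s]
  have h2 := measurePreserving_planeEquiv.integrableOn_comp_preimage
    planeEquiv.measurableEmbedding (f := g) (s := planeEquiv '' (f '' s))
  rw [Set.preimage_image_eq _ planeEquiv.injective] at h2
  exact h2.symm

theorem setIntegral_planeEquiv_image {s : Set (ℝ × ℝ)} (hs : MeasurableSet s)
    {f : ℝ × ℝ → ℝ × ℝ} {f' : ℝ × ℝ → ℝ × ℝ →L[ℝ] ℝ × ℝ}
    (hf' : ∀ x ∈ s, HasFDerivWithinAt f (f' x) s x) (hf : Set.InjOn f s) (g : Plane → ℝ) :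
    ∫ P in (fun x => planeEquiv (f x)) '' s, g P =
      ∫ x in s, |(f' x).det| * g (planeEquiv (f x)) := by
  have h1 := integral_image_eq_integral_abs_det_fderiv_smul volume hs hf' hf
    (fun x => g (planeEquiv x))
  simp only [smul_eq_mul] at h1
  rw [← h1, ← Set.image_image planeEquiv f s]
  have h2 := measurePreserving_planeEquiv.setIntegral_preimage_emb
    planeEquiv.measurableEmbedding g (planeEquiv '' (f '' s))
  rw [Set.preimage_image_eq _ planeEquiv.injective] at h2
  exact h2.symm

/-- The linear map of the plane with matrix rows `(a, b)` and `(c, d)`. -/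
noncomputable def planeLinearMap (a b c d : ℝ) : ℝ × ℝ →L[ℝ] ℝ × ℝ :=
  (a • ContinuousLinearMap.fst ℝ ℝ ℝ + b • ContinuousLinearMap.snd ℝ ℝ ℝ).prod
    (c • ContinuousLinearMap.fst ℝ ℝ ℝ + d • ContinuousLinearMap.snd ℝ ℝ ℝ)

theorem det_planeLinearMap (a b c d : ℝ) : (planeLinearMap a b c d).det = a * d - b * c := by
  rw [planeLinearMap, ← Matrix.toLin_finTwoProd_toContinuousLinearMap]
  simp [LinearMap.det_toContinuousLinearMap, LinearMap.det_toLin]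

/-- The coordinates of the point at distance `T x` from the envelope point on the tangent line with
normal angle `x.1`. -/
noncomputable def rayMap (p : ℝ → ℝ) (T : ℝ × ℝ → ℝ) (x : ℝ × ℝ) : ℝ × ℝ :=
  (p x.1 * cos x.1 - (deriv p x.1 + T x) * sin x.1, p x.1 * sin x.1 + (deriv p x.1 + T x) * cos x.1)

theorem planeEquiv_rayMap (p : ℝ → ℝ) (T : ℝ × ℝ → ℝ) (x : ℝ × ℝ) :
    planeEquiv (rayMap p T x) = tangentPoint p x.1 (T x) := by
  rw [planeEquiv_apply]
  ext i
  fin_cases i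
  · simp [rayMap, tangentPoint_apply_zero]
  · simp [rayMap, tangentPoint_apply_one]

/-- The derivative of `rayMap` where `T` has value `t` and partial derivatives `α` and `β`. -/
noncomputable def rayMapDeriv (p : ℝ → ℝ) (t α β φ : ℝ) : ℝ × ℝ →L[ℝ] ℝ × ℝ :=
  planeLinearMap (-(p φ + deriv (deriv p) φ + α) * sin φ - t * cos φ) (-β * sin φ)
    ((p φ + deriv (deriv p) φ + α) * cos φ - t * sin φ) (β * cos φ)

/-- Only β t survives: the curvature term and α move the point along its tangent line, parallel to
the β direction, and only the rotation of the line contributes transversally. -/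
theorem det_rayMapDeriv (p : ℝ → ℝ) (t α β φ : ℝ) : (rayMapDeriv p t α β φ).det = -(β * t) := by
  have hs := sin_sq_add_cos_sq φ
  rw [rayMapDeriv, det_planeLinearMap]
  linear_combination (-β * t) * hs

theorem hasFDerivAt_comp_fst {g : ℝ → ℝ} {g' : ℝ} {x : ℝ × ℝ} (h : HasDerivAt g g' x.1) :
    HasFDerivAt (fun x : ℝ × ℝ => g x.1) (g' • ContinuousLinearMap.fst ℝ ℝ ℝ) x :=
  HasDerivAt.comp_hasFDerivAt (f := Prod.fst) x h hasFDerivAt_fst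

theorem hasFDerivAt_comp_snd {g : ℝ → ℝ} {g' : ℝ} {x : ℝ × ℝ} (h : HasDerivAt g g' x.2) :
    HasFDerivAt (fun x : ℝ × ℝ => g x.2) (g' • ContinuousLinearMap.snd ℝ ℝ ℝ) x :=
  HasDerivAt.comp_hasFDerivAt (f := Prod.snd) x h hasFDerivAt_snd

theorem hasFDerivAt_rayMap {p : ℝ → ℝ} (hp : ContDiff ℝ 2 p) {T : ℝ × ℝ → ℝ} {x : ℝ × ℝ}
    {α β : ℝ} (hT : HasFDerivAt T
      (α • ContinuousLinearMap.fst ℝ ℝ ℝ + β • ContinuousLinearMap.snd ℝ ℝ ℝ) x) :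
    HasFDerivAt (rayMap p T) (rayMapDeriv p (T x) α β x.1) x := by
  have h0 := hasFDerivAt_comp_fst (hasDerivAt_of_contDiff_two hp x.1)
  have h1 := hasFDerivAt_comp_fst (hasDerivAt_deriv_of_contDiff_two hp x.1)
  have hc := hasFDerivAt_comp_fst (hasDerivAt_cos x.1)
  have hs := hasFDerivAt_comp_fst (hasDerivAt_sin x.1)
  have h := ((h0.mul hc).sub ((h1.add hT).mul hs)).prodMk ((h0.mul hs).add ((h1.add hT).mul hc))
  refine h.congr_fderiv ?_
  refine ContinuousLinearMap.ext fun v => ?_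
  simp [rayMapDeriv, planeLinearMap]
  constructor <;> ring

theorem injOn_rayMap {p : ℝ → ℝ} (hp : ContDiff ℝ 2 p)
    (hper : Function.Periodic p (2 * π)) (hpos : ∀ φ, 0 < p φ + deriv (deriv p) φ)
    {T : ℝ × ℝ → ℝ} {I : Set ℝ} (hT : ∀ φ, ∀ s ∈ I, 0 < T (φ, s))
    (hinj : ∀ φ, Set.InjOn (fun s => T (φ, s)) I) :
    Set.InjOn (rayMap p T) (Set.Ioc 0 (2 * π) ×ˢ I) := by
  rintro ⟨a, s⟩ ⟨ha, hs⟩ ⟨b, u⟩ ⟨hb, hu⟩ h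
  have h1 := congrArg planeEquiv h
  rw [planeEquiv_rayMap, planeEquiv_rayMap] at h1
  obtain ⟨hab, hsu⟩ := tangentPoint_injective hp hper hpos ha hb (hT a s hs) (hT b u hu) h1
  simp only at hab hsu
  subst hab
  exact Prod.ext rfl (hinj a hs hu hsu)

theorem hasFDerivAt_tangentLength {p : ℝ → ℝ} (hp : ContDiff ℝ 2 p) {x : ℝ × ℝ}
    (hx : sin x.2 ≠ 0) :
    HasFDerivAt (fun x : ℝ × ℝ => tangentLength p x.1 x.2)
      (((deriv p (x.1 + x.2) - deriv p x.1 * cos x.2 - deriv (deriv p) x.1 * sin x.2) / sin x.2) •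
        ContinuousLinearMap.fst ℝ ℝ ℝ +
        (gap p (x.1 + x.2) (-x.2) / sin x.2 ^ 2) • ContinuousLinearMap.snd ℝ ℝ ℝ) x := by
  have hadd : HasFDerivAt (fun x : ℝ × ℝ => x.1 + x.2)
      (ContinuousLinearMap.fst ℝ ℝ ℝ + ContinuousLinearMap.snd ℝ ℝ ℝ) x :=
    hasFDerivAt_fst.add hasFDerivAt_snd
  have h2 : HasFDerivAt (fun x : ℝ × ℝ => p (x.1 + x.2)) (deriv p (x.1 + x.2) •
      (ContinuousLinearMap.fst ℝ ℝ ℝ + ContinuousLinearMap.snd ℝ ℝ ℝ)) x :=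
    HasDerivAt.comp_hasFDerivAt (f := fun x : ℝ × ℝ => x.1 + x.2) x
      (hasDerivAt_of_contDiff_two hp (x.1 + x.2)) hadd
  have h0 := hasFDerivAt_comp_fst (hasDerivAt_of_contDiff_two hp x.1)
  have h1 := hasFDerivAt_comp_fst (hasDerivAt_deriv_of_contDiff_two hp x.1)
  have hc := hasFDerivAt_comp_snd (hasDerivAt_cos x.2)
  have hs := hasFDerivAt_comp_snd (hasDerivAt_sin x.2)
  have hi := hasFDerivAt_comp_snd ((hasDerivAt_inv hx).comp x.2 (hasDerivAt_sin x.2))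
  have h := ((h2.sub (h0.mul hc)).sub (h1.mul hs)).mul hi
  refine (h.congr_fderiv (ContinuousLinearMap.ext fun v => ?_)).congr_of_eventuallyEq
    (Filter.Eventually.of_forall fun y => ?_)
  · have := sin_sq_add_cos_sq x.2
    simp [gap]
    field_simp
    linear_combination (p x.1 * v.2) * this
  · simp [tangentLength, gap, div_eq_mul_inv]

theorem sin_pos_of_mem_Ioo {s : ℝ} (hs : s ∈ Set.Ioo 0 π) : 0 < sin s :=
  sin_pos_of_pos_of_lt_pi hs.1 hs.2

/-- The half-open period counts each direction once. The open interval (0, π) omits parallel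
tangents, which have no intersection, so the image is exactly the exterior. -/
theorem image_rayMap_tangentLength {K : Set Plane} (hne : K.Nonempty) (hcomp : IsCompact K)
    (hconv : Convex ℝ K) (hsmooth : ContDiff ℝ 2 (supportFn K))
    (hcurv : ∀ φ, 0 < supportFn K φ + deriv (deriv (supportFn K)) φ) :
    (fun x => planeEquiv (rayMap (supportFn K)
      (fun x => tangentLength (supportFn K) x.1 x.2) x)) '' (Set.Ioc 0 (2 * π) ×ˢ Set.Ioo 0 π)
      = Kᶜ := by
  ext P
  simp only [planeEquiv_rayMap, Set.mem_image, Set.mem_prod, Prod.exists, Set.mem_compl_iff]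
  constructor
  · rintro ⟨φ, s, ⟨-, hs⟩, rfl⟩
    exact tangentPoint_notMem hcomp hsmooth φ (tangentLength_pos hsmooth hcurv φ hs.1 hs.2)
  · intro hP
    obtain ⟨φ, hφ, t, ht, rfl⟩ := exists_tangentPoint_eq hne hcomp hconv hsmooth hcurv hP
    obtain ⟨s, hs, rfl⟩ := exists_tangentLength_eq hsmooth hcurv φ ht
    exact ⟨φ, s, ⟨hφ, hs⟩, rfl⟩

/-! ### The visual angle -/

theorem angle_neg_tangentVec (φ : ℝ) {s : ℝ} (hs : s ∈ Set.Ioo 0 π) :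
    InnerProductGeometry.angle (-tangentVec φ) (tangentVec (φ + s)) = π - s := by
  have hn : ∀ φ, ‖tangentVec φ‖ = 1 := by
    intro φ
    simp [EuclideanSpace.norm_eq, tangentVec]
  rw [InnerProductGeometry.angle_neg_left, InnerProductGeometry.angle, hn, hn, inner_tangentVec]
  have : -(tangentVec φ 0 * sin (φ + s)) + tangentVec φ 1 * cos (φ + s) = cos s := by
    have h := sin_sq_add_cos_sq φ
    simp [tangentVec, sin_add, cos_add]
    linear_combination (cos s) * h
  rw [this, mul_one, div_one, arccos_cos hs.1.le hs.2.le]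

theorem inner_tangentPoint_tangentLength (p : ℝ → ℝ) (φ : ℝ) {s : ℝ} (hs : s ∈ Set.Ioo 0 π) :
    ⟪tangentPoint p φ (tangentLength p φ s), normalVec (φ + s)⟫ = p (φ + s) := by
  have h := sub_inner_tangentPoint p φ (tangentLength p φ s) s
  rw [tangentLength, div_mul_cancel₀ _ (sin_pos_of_mem_Ioo hs).ne', sub_self] at h
  rw [tangentLength]
  linarith

theorem periodic_boundaryCurve (K : Set Plane) : Function.Periodic (boundaryCurve K) (2 * π) := by
  intro φ
  have h1 := periodic_supportFn K φ
  have h2 := periodic_deriv (periodic_supportFn K) φ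
  have h3 : tangentVec (φ + 2 * π) = tangentVec φ := by simp [tangentVec]
  rw [boundaryCurve, envelope, envelope, h1, h2, normalVec_add_two_pi, h3]

theorem inner_boundaryCurve (K : Set Plane) (φ : ℝ) :
    ⟪boundaryCurve K φ, normalVec φ⟫ = supportFn K φ := by
  rw [boundaryCurve, ← tangentPoint_zero, inner_tangentPoint]

theorem tangencyPoints_tangentPoint {K : Set Plane} (hne : K.Nonempty) (hcomp : IsCompact K)
    (hsmooth : ContDiff ℝ 2 (supportFn K))
    (hcurv : ∀ φ, 0 < supportFn K φ + deriv (deriv (supportFn K)) φ) (φ : ℝ) {s : ℝ}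
    (hs : s ∈ Set.Ioo 0 π) :
    tangencyPoints K (tangentPoint (supportFn K) φ (tangentLength (supportFn K) φ s)) =
      {boundaryCurve K φ, boundaryCurve K (φ + s)} := by
  have hd : ∀ ψ, DifferentiableAt ℝ (supportFn K) ψ := fun ψ =>
    (hasDerivAt_of_contDiff_two hsmooth ψ).differentiableAt
  ext x
  simp only [tangencyPoints, Set.mem_ofPred_eq, Set.mem_insert_iff, Set.mem_singleton_iff]
  constructor
  · rintro ⟨hx, ψ, h1, h2⟩
    have hxψ := eq_boundaryCurve hcomp (hd ψ) hx h1
    -- The angle is reduced to an offset u in [0, 2π). Then u = 0 is the first tangent; otherwise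
    -- the identity gap = t sin u forces u < π, and monotonicity of the tangent length forces u = s.
    obtain ⟨m, hm, -⟩ := existsUnique_sub_zsmul_mem_Ico (show 0 < 2 * π by positivity) (ψ - φ) 0
    set u := ψ - φ - m • (2 * π) with hu
    have hψ : ψ = φ + u + m • (2 * π) := by rw [hu]; ring
    rw [zero_add] at hm
    have hxu : x = boundaryCurve K (φ + u) := by
      rw [hxψ, hψ, (periodic_boundaryCurve K).zsmul m]
    have hPu : ⟪tangentPoint (supportFn K) φ (tangentLength (supportFn K) φ s),
        normalVec (φ + u)⟫ = supportFn K (φ + u) := by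
      have h3 : normalVec ψ = normalVec (φ + u) := by
        rw [hψ]
        exact Function.Periodic.zsmul (f := normalVec) normalVec_add_two_pi m _
      rw [← h3, h2, hψ, (periodic_supportFn K).zsmul m]
    rcases hm.1.eq_or_lt with h0 | h0
    · left; rw [hxu, ← h0, add_zero]
    · right
      have h4 := sub_inner_tangentPoint (supportFn K) φ (tangentLength (supportFn K) φ s) u
      rw [hPu, sub_self] at h4
      have h5 := gap_pos hsmooth (periodic_supportFn K) hcurv φ h0 hm.2
      have h6 := tangentLength_pos hsmooth hcurv φ hs.1 hs.2
      have h7 : 0 < sin u := pos_of_mul_pos_right (by linarith) h6.le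
      have h8 : u < π := by
        by_contra hle
        have : 0 ≤ sin (2 * π - u) :=
          sin_nonneg_of_nonneg_of_le_pi (by linarith [hm.2]) (by linarith [not_lt.1 hle])
        rw [sin_two_pi_sub] at this
        linarith
      have h9 : tangentLength (supportFn K) φ u = tangentLength (supportFn K) φ s := by
        rw [tangentLength, div_eq_iff h7.ne']
        linarith
      rw [hxu, (strictMonoOn_tangentLength hsmooth hcurv φ).injOn ⟨h0, h8⟩ hs h9]
  · rintro (rfl | rfl)
    · exact ⟨boundaryCurve_mem hne hcomp (hd _), φ, inner_boundaryCurve K φ,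
        inner_tangentPoint _ _ _⟩
    · exact ⟨boundaryCurve_mem hne hcomp (hd _), φ + s, inner_boundaryCurve K _,
        inner_tangentPoint_tangentLength _ _ hs⟩

theorem visualAngle_tangentPoint {K : Set Plane} (hne : K.Nonempty) (hcomp : IsCompact K)
    (hsmooth : ContDiff ℝ 2 (supportFn K))
    (hcurv : ∀ φ, 0 < supportFn K φ + deriv (deriv (supportFn K)) φ) (φ : ℝ) {s : ℝ}
    (hs : s ∈ Set.Ioo 0 π) :
    visualAngle K (tangentPoint (supportFn K) φ (tangentLength (supportFn K) φ s)) = π - s := by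
  set p := supportFn K with hp
  set t := tangentLength p φ s with ht
  set P := tangentPoint p φ t with hP
  have ht0 : 0 < t := tangentLength_pos hsmooth hcurv φ hs.1 hs.2
  have hsin := sin_pos_of_mem_Ioo hs
  have ha : boundaryCurve K φ -ᵥ P = t • -tangentVec φ := by
    rw [vsub_eq_sub, hP, tangentPoint, boundaryCurve, ← hp, smul_neg]
    abel
  have hPs := eq_tangentPoint p (inner_tangentPoint_tangentLength p φ hs)
  set u := ⟪tangentPoint p φ (tangentLength p φ s), tangentVec (φ + s)⟫ - deriv p (φ + s)
  rw [← ht, ← hP] at hPs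
  -- On the second tangent the point lies on the backward ray; hence the two directions towards the
  -- contact points are -N'(φ) and N'(φ + s), and they meet at the angle π - s.
  have hu : 0 < -u := by
    have h1 := sub_inner_tangentPoint p (φ + s) u (-s)
    rw [← hPs, add_neg_cancel_right, hP, inner_tangentPoint, sub_self, sin_neg] at h1
    have h2 := gap_neg_pos hsmooth hcurv φ hs.1 hs.2
    exact pos_of_mul_pos_left (a := -u) (b := sin s) (by linarith) hsin.le
  have hb : boundaryCurve K (φ + s) -ᵥ P = (-u) • tangentVec (φ + s) := by
    rw [vsub_eq_sub, hPs, tangentPoint, boundaryCurve, ← hp, neg_smul]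
    abel
  have hab : EuclideanGeometry.angle (boundaryCurve K φ) P (boundaryCurve K (φ + s)) = π - s := by
    rw [EuclideanGeometry.angle, ha, hb, InnerProductGeometry.angle_smul_left_of_pos _ _ ht0,
      InnerProductGeometry.angle_smul_right_of_pos _ _ hu, angle_neg_tangentVec φ hs]
  have hPK : P ∉ K := tangentPoint_notMem hcomp hsmooth φ ht0
  have hne' : ∀ ψ, boundaryCurve K ψ ≠ P := by
    intro ψ h
    exact hPK (h ▸ boundaryCurve_mem hne hcomp
      (hasDerivAt_of_contDiff_two hsmooth ψ).differentiableAt)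
  rw [visualAngle, tangencyPoints_tangentPoint hne hcomp hsmooth hcurv φ hs]
  refine IsGreatest.csSup_eq ⟨⟨_, Or.inl rfl, _, Or.inr rfl, hab.symm⟩, ?_⟩
  rintro θ ⟨x, hx, y, hy, rfl⟩
  rcases hx with rfl | rfl <;> rcases hy with rfl | rfl
  · rw [EuclideanGeometry.angle_self_of_ne (hne' _)]; linarith [hs.2]
  · exact hab.le
  · rw [EuclideanGeometry.angle_comm]; exact hab.le
  · rw [EuclideanGeometry.angle_self_of_ne (hne' _)]; linarith [hs.2]

/-! ### The integral of `sin³ ω` -/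

/-- The product of the distances of the envelope points `φ` and `φ + s` from each other's
support lines. -/
noncomputable def gapProduct (p : ℝ → ℝ) (φ s : ℝ) : ℝ := gap p φ s * gap p (φ + s) (-s)

theorem continuous_gapProduct {p : ℝ → ℝ} (hp : ContDiff ℝ 2 p) :
    Continuous fun x : ℝ × ℝ => gapProduct p x.1 x.2 := by
  have h0 := hp.continuous
  have h1 := continuous_deriv_of_contDiff_two hp
  unfold gapProduct gap
  fun_prop

/-- Both claims come from one change of variables. The transformed integrand is continuous on the
closed rectangle, which gives integrability without any estimate at infinity. -/
theorem integral_sin_visualAngle {K : Set Plane} (hne : K.Nonempty) (hcomp : IsCompact K)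
    (hconv : Convex ℝ K) (hsmooth : ContDiff ℝ 2 (supportFn K))
    (hcurv : ∀ φ, 0 < supportFn K φ + deriv (deriv (supportFn K)) φ) :
    IntegrableOn (fun P => sin (visualAngle K P) ^ 3) Kᶜ volume ∧
      ∫ P in Kᶜ, sin (visualAngle K P) ^ 3 =
        ∫ φ in (0 : ℝ)..(2 * π), ∫ s in (0 : ℝ)..π, gapProduct (supportFn K) φ s := by
  set p := supportFn K with hp
  have hmeas : MeasurableSet (Set.Ioc 0 (2 * π) ×ˢ Set.Ioo 0 π) :=
    measurableSet_Ioc.prod measurableSet_Ioo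
  have hderiv : ∀ x ∈ Set.Ioc 0 (2 * π) ×ˢ Set.Ioo 0 π,
      HasFDerivWithinAt (rayMap p fun x => tangentLength p x.1 x.2) _
        (Set.Ioc 0 (2 * π) ×ˢ Set.Ioo 0 π) x := fun x hx =>
    (hasFDerivAt_rayMap hsmooth (hasFDerivAt_tangentLength hsmooth
      (sin_pos_of_mem_Ioo hx.2).ne')).hasFDerivWithinAt
  have hinj := injOn_rayMap hsmooth (periodic_supportFn K) hcurv
    (T := fun x => tangentLength p x.1 x.2) (I := Set.Ioo 0 π)
    (fun φ s hs => tangentLength_pos hsmooth hcurv φ hs.1 hs.2)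
    (fun φ => (strictMonoOn_tangentLength hsmooth hcurv φ).injOn)
  have hint := integrableOn_planeEquiv_image_iff hmeas hderiv hinj
    (fun P => sin (visualAngle K P) ^ 3)
  have hval := setIntegral_planeEquiv_image hmeas hderiv hinj
    (fun P => sin (visualAngle K P) ^ 3)
  rw [image_rayMap_tangentLength hne hcomp hconv hsmooth hcurv] at hint hval
  -- The tangent length contributes 1/sin s and its s-derivative 1/sin² s; since sin ω = sin(π - s)
  -- = sin s, the cube cancels them exactly.
  have heq : ∀ x ∈ Set.Ioc 0 (2 * π) ×ˢ Set.Ioo 0 π,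
      |(rayMapDeriv p (tangentLength p x.1 x.2) ((deriv p (x.1 + x.2) - deriv p x.1 * cos x.2 -
        deriv (deriv p) x.1 * sin x.2) / sin x.2) (gap p (x.1 + x.2) (-x.2) / sin x.2 ^ 2)
        x.1).det| * sin (visualAngle K (planeEquiv (rayMap p
          (fun x => tangentLength p x.1 x.2) x))) ^ 3 = gapProduct p x.1 x.2 := by
    rintro ⟨φ, s⟩ ⟨-, hs⟩
    simp only at hs ⊢
    have hsin := sin_pos_of_mem_Ioo hs
    have h1 := tangentLength_pos hsmooth hcurv φ hs.1 hs.2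
    have h2 := gap_neg_pos hsmooth hcurv φ hs.1 hs.2
    rw [planeEquiv_rayMap, visualAngle_tangentPoint hne hcomp hsmooth hcurv φ hs,
      det_rayMapDeriv, abs_neg, abs_of_pos (by positivity), sin_pi_sub, tangentLength, gapProduct]
    field_simp
  have hcont := continuous_gapProduct hsmooth
  have hcints : IntegrableOn (fun x : ℝ × ℝ => gapProduct p x.1 x.2)
      (Set.Ioc 0 (2 * π) ×ˢ Set.Ioo 0 π) volume :=
    (hcont.continuousOn.integrableOn_compact
      (isCompact_Icc.prod isCompact_Icc : IsCompact (Set.Icc 0 (2 * π) ×ˢ Set.Icc 0 π))).mono_set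
      (Set.prod_mono Set.Ioc_subset_Icc_self Set.Ioo_subset_Icc_self)
  refine ⟨hint.2 ((integrableOn_congr_fun heq hmeas).2 hcints), ?_⟩
  rw [hval, setIntegral_congr_fun hmeas heq, Measure.volume_eq_prod,
    setIntegral_prod _ (by rwa [← Measure.volume_eq_prod]),
    intervalIntegral.integral_of_le (by positivity)]
  refine setIntegral_congr_fun measurableSet_Ioc fun φ _ => ?_
  simp only
  rw [intervalIntegral.integral_of_le pi_pos.le, integral_Ioc_eq_integral_Ioo]

/-! ### The area -/

theorem norm_tangentPoint_sq (p : ℝ → ℝ) (φ t : ℝ) :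
    ‖tangentPoint p φ t‖ ^ 2 = p φ ^ 2 + (deriv p φ + t) ^ 2 := by
  have h := sin_sq_add_cos_sq φ
  rw [EuclideanSpace.norm_sq_eq, Fin.sum_univ_two, tangentPoint_apply_zero, tangentPoint_apply_one]
  simp only [Real.norm_eq_abs, sq_abs]
  linear_combination (p φ ^ 2 + (deriv p φ + t) ^ 2) * h

/-- The same rays, cut off at a large ball: τ(φ) is the length of the ray inside the ball. Rescaling
it to the unit interval gives the Jacobian τ² s, and the s-integral yields the factor 1/2. -/
theorem integral_area_exterior {K : Set Plane} (hne : K.Nonempty) (hcomp : IsCompact K)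
    (hconv : Convex ℝ K) (hsmooth : ContDiff ℝ 2 (supportFn K))
    (hcurv : ∀ φ, 0 < supportFn K φ + deriv (deriv (supportFn K)) φ) {R : ℝ} (hR : 0 < R)
    (hKR : K ⊆ Metric.ball 0 R) :
    volume.real (Metric.ball (0 : Plane) R \ K) = (1 / 2) * ∫ φ in (0 : ℝ)..(2 * π),
      (√(R ^ 2 - supportFn K φ ^ 2) - deriv (supportFn K) φ) ^ 2 := by
  set p := supportFn K with hp
  have hbound : ∀ φ, p φ ^ 2 + deriv p φ ^ 2 < R ^ 2 := by
    intro φ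
    have h1 := hKR (boundaryCurve_mem hne hcomp (φ := φ)
      (hasDerivAt_of_contDiff_two hsmooth φ).differentiableAt)
    have h2 := norm_tangentPoint_sq p φ 0
    rw [tangentPoint_zero, add_zero] at h2
    rw [mem_ball_zero_iff] at h1
    rw [← h2]
    exact pow_lt_pow_left₀ h1 (norm_nonneg _) two_ne_zero
  set τ : ℝ → ℝ := fun φ => √(R ^ 2 - p φ ^ 2) - deriv p φ with hτ
  have hroot : ∀ φ, 0 < R ^ 2 - p φ ^ 2 := fun φ => by
    have := hbound φ; have := sq_nonneg (deriv p φ); linarith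
  have habs : ∀ φ, |deriv p φ| < √(R ^ 2 - p φ ^ 2) := fun φ => by
    rw [← Real.sqrt_sq_eq_abs]
    exact Real.sqrt_lt_sqrt (sq_nonneg _) (by linarith [hbound φ])
  have hτpos : ∀ φ, 0 < τ φ := fun φ => sub_pos.2 ((le_abs_self _).trans_lt (habs φ))
  have hτd : ∀ φ, ∃ τ', HasDerivAt τ τ' φ := fun φ =>
    ⟨_, ((((hasDerivAt_of_contDiff_two hsmooth φ).pow 2).const_sub (R ^ 2)).sqrt
      (hroot φ).ne').sub (hasDerivAt_deriv_of_contDiff_two hsmooth φ)⟩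
  choose τ' hτ' using hτd
  have hmeas : MeasurableSet (Set.Ioc 0 (2 * π) ×ˢ Set.Ioo (0 : ℝ) 1) :=
    measurableSet_Ioc.prod measurableSet_Ioo
  have hderiv : ∀ x ∈ Set.Ioc 0 (2 * π) ×ˢ Set.Ioo (0 : ℝ) 1,
      HasFDerivWithinAt (rayMap p fun x => τ x.1 * x.2)
        (rayMapDeriv p (τ x.1 * x.2) (τ' x.1 * x.2) (τ x.1) x.1)
        (Set.Ioc 0 (2 * π) ×ˢ Set.Ioo (0 : ℝ) 1) x := fun x _ => by
    refine (hasFDerivAt_rayMap hsmooth ?_).hasFDerivWithinAt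
    refine ((hasFDerivAt_comp_fst (hτ' x.1)).mul hasFDerivAt_snd).congr_fderiv
      (ContinuousLinearMap.ext fun v => ?_)
    simp
    ring
  have hinj := injOn_rayMap hsmooth (periodic_supportFn K) hcurv
    (T := fun x => τ x.1 * x.2) (I := Set.Ioo (0 : ℝ) 1)
    (fun φ s hs => mul_pos (hτpos φ) hs.1)
    (fun φ s _ u _ h => mul_left_cancel₀ (hτpos φ).ne' h)
  have hval := setIntegral_planeEquiv_image hmeas hderiv hinj (fun _ => 1)
  have himage : (fun x => planeEquiv (rayMap p (fun x => τ x.1 * x.2) x)) ''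
      (Set.Ioc 0 (2 * π) ×ˢ Set.Ioo (0 : ℝ) 1) = Metric.ball 0 R \ K := by
    have hball : ∀ φ t, 0 < t → (tangentPoint p φ t ∈ Metric.ball (0 : Plane) R ↔ t < τ φ) := by
      intro φ t ht
      rw [mem_ball_zero_iff, ← sq_lt_sq₀ (norm_nonneg _) hR.le, norm_tangentPoint_sq,
        ← lt_sub_iff_add_lt', Real.sq_lt]
      have h1 := (abs_lt.1 (habs φ)).1
      simp only [hτ]
      -- Only the far intersection with the circle matters, since the contact point is inside the
      -- ball and t > 0.
      exact ⟨fun h => by linarith [h.2], fun h => ⟨by linarith, by linarith⟩⟩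
    ext P
    simp only [planeEquiv_rayMap, Set.mem_image, Set.mem_prod, Prod.exists, Set.mem_sdiff]
    constructor
    · rintro ⟨φ, s, ⟨-, hs⟩, rfl⟩
      have hpos := mul_pos (hτpos φ) hs.1
      refine ⟨(hball φ _ hpos).2 ?_, tangentPoint_notMem hcomp hsmooth φ hpos⟩
      exact mul_lt_of_lt_one_right (hτpos φ) hs.2
    · rintro ⟨hPR, hP⟩
      obtain ⟨φ, hφ, t, ht, rfl⟩ := exists_tangentPoint_eq hne hcomp hconv hsmooth hcurv hP
      rw [← hp, hball φ t ht] at hPR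
      refine ⟨φ, t / τ φ, ⟨hφ, div_pos ht (hτpos φ), (div_lt_one (hτpos φ)).2 hPR⟩, ?_⟩
      rw [mul_div_cancel₀ _ (hτpos φ).ne']
  have hcτ : Continuous τ := continuous_iff_continuousAt.2 fun φ => (hτ' φ).continuousAt
  rw [himage] at hval
  have heq : ∀ x ∈ Set.Ioc 0 (2 * π) ×ˢ Set.Ioo (0 : ℝ) 1,
      |(rayMapDeriv p (τ x.1 * x.2) (τ' x.1 * x.2) (τ x.1) x.1).det| * 1 = τ x.1 ^ 2 * x.2 := by
    intro x hx
    have h1 := hτpos x.1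
    have h2 : 0 < x.2 := hx.2.1
    rw [det_rayMapDeriv, abs_neg, abs_of_pos (by positivity)]
    ring
  have h1 : volume.real (Metric.ball (0 : Plane) R \ K) =
      ∫ _ in Metric.ball (0 : Plane) R \ K, (1 : ℝ) := by simp
  rw [h1, hval, setIntegral_congr_fun hmeas heq, Measure.volume_eq_prod,
    setIntegral_prod_mul (fun φ => τ φ ^ 2) (fun s => s), ← integral_Ioc_eq_integral_Ioo,
    ← intervalIntegral.integral_of_le (by positivity),
    ← intervalIntegral.integral_of_le zero_le_one, integral_id]
  ring

/-- In the expansion of τ² the constant R² integrates to the area of the ball, and the square root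
cancels except in the cross term with p', which is an exact derivative in p and integrates to zero
over a period. -/
theorem area_eq_signedArea {K : Set Plane} (hne : K.Nonempty) (hcomp : IsCompact K)
    (hconv : Convex ℝ K) (hsmooth : ContDiff ℝ 2 (supportFn K))
    (hcurv : ∀ φ, 0 < supportFn K φ + deriv (deriv (supportFn K)) φ) :
    area K = signedArea (supportFn K) := by
  obtain ⟨R, hR, hKR⟩ := hcomp.isBounded.subset_ball_lt 0 0
  have h := integral_area_exterior hne hcomp hconv hsmooth hcurv hR hKR
  rw [measureReal_sdiff hKR hcomp.measurableSet] at h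
  have hball : volume.real (Metric.ball (0 : Plane) R) = π * R ^ 2 := by
    rw [measureReal_def, EuclideanSpace.volume_ball_fin_two]
    simp [hR.le, pi_pos.le]
    ring
  have hbound : ∀ φ, supportFn K φ ^ 2 ≤ R ^ 2 := by
    intro φ
    obtain ⟨x, hx, h⟩ := exists_inner_eq_supportFn hne hcomp φ
    rw [← h]
    have h1 := hKR hx
    rw [mem_ball_zero_iff] at h1
    have h2 := abs_real_inner_le_norm x (normalVec φ)
    have h3 : ‖normalVec φ‖ = 1 := by simp [EuclideanSpace.norm_eq, normalVec]
    rw [h3, mul_one] at h2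
    exact sq_le_sq' (by linarith [(abs_le.1 h2).1]) ((le_abs_self _).trans (h2.trans h1.le))
  have hc := hsmooth.continuous
  have hc' := continuous_deriv_of_contDiff_two hsmooth
  have hzero : ∫ φ in (0 : ℝ)..(2 * π),
      √(R ^ 2 - supportFn K φ ^ 2) * deriv (supportFn K) φ = 0 := by
    have h1 := intervalIntegral.integral_comp_mul_deriv (a := 0) (b := 2 * π)
      (fun φ _ => hasDerivAt_of_contDiff_two hsmooth φ) hc'.continuousOn
      (g := fun u => √(R ^ 2 - u ^ 2)) (by fun_prop)
    have h2 : supportFn K (2 * π) = supportFn K 0 := by simpa using periodic_supportFn K 0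
    rw [h2, intervalIntegral.integral_same] at h1
    exact h1
  have hexp : ∀ φ, (√(R ^ 2 - supportFn K φ ^ 2) - deriv (supportFn K) φ) ^ 2 =
      R ^ 2 - (supportFn K φ ^ 2 - deriv (supportFn K) φ ^ 2)
        - 2 * (√(R ^ 2 - supportFn K φ ^ 2) * deriv (supportFn K) φ) := by
    intro φ
    rw [sub_sq, Real.sq_sqrt (by linarith [hbound φ])]
    ring
  simp only [hexp] at h
  rw [intervalIntegral.integral_sub, intervalIntegral.integral_sub,
    intervalIntegral.integral_const_mul, hzero, hball] at h
  · rw [area, signedArea, ← measureReal_def]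
    simp at h
    linarith
  all_goals exact (by fun_prop : Continuous _).intervalIntegrable _ _

/-! ### The double integral of the gap product -/

/-- The product is symmetric in the two tangents; modulo 2π both sides describe the pair with normal
angles φ and φ - s. -/
theorem gapProduct_two_pi_sub {p : ℝ → ℝ} (hper : Function.Periodic p (2 * π)) (φ s : ℝ) :
    gapProduct p φ (2 * π - s) = gapProduct p (φ - s) s := by
  have h1 := gap_add_two_pi hper φ (-s)
  have h2 := gap_add_two_pi_left hper (φ - s) (s - 2 * π)
  have h3 := gap_add_two_pi hper (φ - s) (s - 2 * π)
  rw [gapProduct, gapProduct, sub_add_cancel, mul_comm, neg_sub,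
    show 2 * π - s = -s + 2 * π by ring, h1, show φ + (-s + 2 * π) = φ - s + 2 * π by ring, h2, ← h3,
    sub_add_cancel]

theorem gapProduct_add_two_pi_left {p : ℝ → ℝ} (hper : Function.Periodic p (2 * π)) (φ s : ℝ) :
    gapProduct p (φ + 2 * π) s = gapProduct p φ s := by
  rw [gapProduct, gapProduct, gap_add_two_pi_left hper, add_right_comm, gap_add_two_pi_left hper]

theorem gapProduct_add_two_pi {p : ℝ → ℝ} (hper : Function.Periodic p (2 * π)) (φ s : ℝ) :
    gapProduct p φ (s + 2 * π) = gapProduct p φ s := by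
  have h := gap_add_two_pi hper (φ + s) (-(s + 2 * π))
  rw [gapProduct, gapProduct, gap_add_two_pi hper, ← add_assoc, gap_add_two_pi_left hper, ← h]
  congr 2; ring

theorem integral_comp_sub_of_periodic {f : ℝ → ℝ} (hf : Function.Periodic f (2 * π)) (a : ℝ) :
    ∫ x in (0 : ℝ)..(2 * π), f (x - a) = ∫ x in (0 : ℝ)..(2 * π), f x := by
  rw [intervalIntegral.integral_comp_sub_right]
  have := hf.intervalIntegral_add_eq (-a) 0
  rw [zero_add] at this
  rw [← this]
  congr 1 <;> ring

theorem integral_integral_comm {f : ℝ × ℝ → ℝ} (hf : Continuous f) {a b c d : ℝ} (hab : a ≤ b)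
    (hcd : c ≤ d) :
    ∫ x in a..b, ∫ y in c..d, f (x, y) = ∫ y in c..d, ∫ x in a..b, f (x, y) := by
  simp only [intervalIntegral.integral_of_le hab, intervalIntegral.integral_of_le hcd]
  refine integral_integral_swap ?_
  rw [Measure.prod_restrict, ← Measure.volume_eq_prod]
  exact (hf.continuousOn.integrableOn_compact (isCompact_Icc.prod isCompact_Icc :
    IsCompact (Set.Icc a b ×ˢ Set.Icc c d))).mono_set
      (Set.prod_mono Set.Ioc_subset_Icc_self Set.Ioc_subset_Icc_self)

/-- Full periods in both variables are needed to bring in Fourier coefficients. Exchanging the two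
tangents carries s in [π, 2π] to s in [0, π], at the cost of a shift of φ that integration over a
period ignores. -/
theorem integral_gapProduct_two_pi {p : ℝ → ℝ} (hp : ContDiff ℝ 2 p)
    (hper : Function.Periodic p (2 * π)) :
    ∫ φ in (0 : ℝ)..(2 * π), ∫ s in (0 : ℝ)..(2 * π), gapProduct p φ s =
      2 * ∫ φ in (0 : ℝ)..(2 * π), ∫ s in (0 : ℝ)..π, gapProduct p φ s := by
  have hcont := continuous_gapProduct hp
  have hcont1 : ∀ φ, Continuous (gapProduct p φ) := fun φ =>
    hcont.comp (by fun_prop : Continuous fun s : ℝ => (φ, s))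
  have hsplit : ∀ φ, ∫ s in (0 : ℝ)..(2 * π), gapProduct p φ s =
      (∫ s in (0 : ℝ)..π, gapProduct p φ s) + ∫ s in (0 : ℝ)..π, gapProduct p (φ - s) s := by
    intro φ
    rw [← intervalIntegral.integral_add_adjacent_intervals
      ((hcont1 φ).intervalIntegrable 0 π) ((hcont1 φ).intervalIntegrable π (2 * π))]
    congr 1
    simp only [← gapProduct_two_pi_sub hper]
    rw [intervalIntegral.integral_comp_sub_left]
    congr 1 <;> ring
  have hcont2 : Continuous fun x : ℝ × ℝ => gapProduct p (x.1 - x.2) x.2 :=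
    hcont.comp (by fun_prop : Continuous fun x : ℝ × ℝ => (x.1 - x.2, x.2))
  have hswap : ∫ φ in (0 : ℝ)..(2 * π), ∫ s in (0 : ℝ)..π, gapProduct p (φ - s) s =
      ∫ φ in (0 : ℝ)..(2 * π), ∫ s in (0 : ℝ)..π, gapProduct p φ s := by
    have h1 := integral_integral_comm hcont2 (show 0 ≤ 2 * π by positivity) pi_pos.le
    have h2 := integral_integral_comm hcont (show 0 ≤ 2 * π by positivity) pi_pos.le
    simp only at h1 h2
    rw [h1, h2]
    congr 1; funext s
    exact integral_comp_sub_of_periodic (f := fun φ => gapProduct p φ s)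
      (fun φ => gapProduct_add_two_pi_left hper φ s) s
  simp only [hsplit]
  rw [intervalIntegral.integral_add, hswap]
  · ring
  · exact (intervalIntegral.continuous_parametric_intervalIntegral_of_continuous'
      (f := gapProduct p) hcont 0 π).intervalIntegrable _ _
  · exact (intervalIntegral.continuous_parametric_intervalIntegral_of_continuous'
      (f := fun φ s => gapProduct p (φ - s) s) hcont2 0 π).intervalIntegrable _ _

theorem integral_gapProduct_inner {p : ℝ → ℝ} (hp : ContDiff ℝ 2 p)
    (hper : Function.Periodic p (2 * π)) (φ : ℝ) :
    ∫ s in (0 : ℝ)..(2 * π), gapProduct p φ s =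
      3 / 2 * p φ * (∫ ψ in (0 : ℝ)..(2 * π), p ψ)
      + 3 / 2 * (p φ * cos (2 * φ) - deriv p φ * sin (2 * φ)) * cosCoeff p 2
      + 3 / 2 * (p φ * sin (2 * φ) + deriv p φ * cos (2 * φ)) * sinCoeff p 2
      - 3 / 2 * cos φ * (∫ ψ in (0 : ℝ)..(2 * π), p ψ ^ 2 * cos ψ)
      - 3 / 2 * sin φ * (∫ ψ in (0 : ℝ)..(2 * π), p ψ ^ 2 * sin ψ) := by
  have hc := hp.continuous
  have hc' := continuous_deriv_of_contDiff_two hp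
  have hshift := integral_comp_sub_of_periodic (f := gapProduct p φ)
    (fun s => gapProduct_add_two_pi hper φ s) φ
  -- With ψ = φ + s, this periodic primitive absorbs all terms of the product containing p'(ψ). It
  -- amounts to integration by parts in ψ with φ frozen.
  have hE : ∀ ψ, HasDerivAt (fun ψ => p ψ ^ 2 * sin (ψ - φ) / 2
      - p φ * (p ψ * (cos (ψ - φ) * sin (ψ - φ))) - deriv p φ * (p ψ * sin (ψ - φ) ^ 2))
      (p ψ * deriv p ψ * sin (ψ - φ) + p ψ ^ 2 * cos (ψ - φ) / 2
      - p φ * (deriv p ψ * (cos (ψ - φ) * sin (ψ - φ))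
        + p ψ * (cos (ψ - φ) ^ 2 - sin (ψ - φ) ^ 2))
      - deriv p φ * (deriv p ψ * sin (ψ - φ) ^ 2
        + p ψ * (2 * sin (ψ - φ) * cos (ψ - φ)))) ψ := by
    intro ψ
    have h0 := hasDerivAt_of_contDiff_two hp ψ
    have hid : HasDerivAt (fun ψ => ψ - φ) 1 ψ := (hasDerivAt_id ψ).sub_const φ
    have h := ((((h0.pow 2).mul hid.sin).div_const 2).sub
      ((h0.mul (hid.cos.mul hid.sin)).const_mul (p φ))).sub
      ((h0.mul (hid.sin.pow 2)).const_mul (deriv p φ))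
    refine h.congr_deriv ?_
    simp
    ring
  have hzero := integral_deriv_of_periodic hE (by fun_prop) (by
    intro ψ
    simp only [hper ψ, show ψ + 2 * π - φ = ψ - φ + 2 * π by ring, sin_add_two_pi, cos_add_two_pi])
  -- Apart from the exact derivative, every remaining term is a function of φ times p(ψ), p(ψ) times
  -- a frequency 2 function, p(ψ)² times a frequency 1 function, or a plain sine or cosine of ψ.
  have hpoint : ∀ ψ, gapProduct p φ (ψ - φ) =
      (p ψ * deriv p ψ * sin (ψ - φ) + p ψ ^ 2 * cos (ψ - φ) / 2
      - p φ * (deriv p ψ * (cos (ψ - φ) * sin (ψ - φ))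
        + p ψ * (cos (ψ - φ) ^ 2 - sin (ψ - φ) ^ 2))
      - deriv p φ * (deriv p ψ * sin (ψ - φ) ^ 2
        + p ψ * (2 * sin (ψ - φ) * cos (ψ - φ))))
      + 3 / 2 * p φ * p ψ
      + 3 / 2 * (p φ * cos (2 * φ) - deriv p φ * sin (2 * φ)) * (p ψ * cos ((2 : ℤ) * ψ))
      + 3 / 2 * (p φ * sin (2 * φ) + deriv p φ * cos (2 * φ)) * (p ψ * sin ((2 : ℤ) * ψ))
      - 3 / 2 * cos φ * (p ψ ^ 2 * cos ψ) - 3 / 2 * sin φ * (p ψ ^ 2 * sin ψ)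
      - (p φ ^ 2 * cos φ - p φ * deriv p φ * sin φ) * cos ψ
      - (p φ ^ 2 * sin φ + p φ * deriv p φ * cos φ) * sin ψ := by
    intro ψ
    have h1 : cos (ψ - φ) = cos ψ * cos φ + sin ψ * sin φ := cos_sub ψ φ
    have h2 : sin (ψ - φ) = sin ψ * cos φ - cos ψ * sin φ := sin_sub ψ φ
    have h3 : 2 * cos (ψ - φ) ^ 2 - 1 = cos (2 * ψ) * cos (2 * φ) + sin (2 * ψ) * sin (2 * φ) := by
      rw [← cos_two_mul, ← cos_sub]; congr 1; ring
    have h4 : 2 * sin (ψ - φ) * cos (ψ - φ) =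
        sin (2 * ψ) * cos (2 * φ) - cos (2 * ψ) * sin (2 * φ) := by
      rw [← sin_two_mul, ← sin_sub]; congr 1; ring
    have h5 := sin_sq_add_cos_sq (ψ - φ)
    rw [gapProduct, gap, gap, cos_neg, sin_neg, add_sub_cancel, ← sub_eq_add_neg, sub_sub_cancel]
    push_cast
    linear_combination (-(p φ * p ψ)) * h5 + (3 / 2 * p φ * p ψ) * h3
      + (3 / 2 * deriv p φ * p ψ) * h4 - (3 / 2 * p ψ ^ 2 + p φ ^ 2) * h1 - p φ * deriv p φ * h2
  have hcos : ∫ ψ in (0 : ℝ)..(2 * π), cos ψ = 0 := by simp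
  have hsin : ∫ ψ in (0 : ℝ)..(2 * π), sin ψ = 0 := by simp
  rw [← hshift]
  simp only [hpoint]
  rw [intervalIntegral.integral_sub, intervalIntegral.integral_sub, intervalIntegral.integral_sub,
    intervalIntegral.integral_sub, intervalIntegral.integral_add, intervalIntegral.integral_add,
    intervalIntegral.integral_add, hzero, intervalIntegral.integral_const_mul,
    intervalIntegral.integral_const_mul, intervalIntegral.integral_const_mul,
    intervalIntegral.integral_const_mul, intervalIntegral.integral_const_mul,
    intervalIntegral.integral_const_mul, intervalIntegral.integral_const_mul, hcos, hsin,
    cosCoeff, sinCoeff]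
  · ring
  all_goals exact (by fun_prop : Continuous _).intervalIntegrable _ _

/-- The p² terms of the inner integral come with cos φ or sin φ and disappear on integrating in φ.
The terms with p' have frequency 2 and give twice the contribution of those with p, which turns 3/2
into 9/2 before halving. -/
theorem integral_gapProduct {p : ℝ → ℝ} (hp : ContDiff ℝ 2 p)
    (hper : Function.Periodic p (2 * π)) :
    ∫ φ in (0 : ℝ)..(2 * π), ∫ s in (0 : ℝ)..π, gapProduct p φ s =
      3 / 4 * (∫ φ in (0 : ℝ)..(2 * π), p φ) ^ 2 + 9 / 4 * power p 2 := by
  have hc := hp.continuous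
  have hc' := continuous_deriv_of_contDiff_two hp
  have h := integral_gapProduct_two_pi hp hper
  simp only [integral_gapProduct_inner hp hper] at h
  have hcos : ∫ ψ in (0 : ℝ)..(2 * π), cos ψ = 0 := by simp
  have hsin : ∫ ψ in (0 : ℝ)..(2 * π), sin ψ = 0 := by simp
  have h1 := cosCoeff_deriv (hasDerivAt_of_contDiff_two hp) hc' hper 2
  have h2 := sinCoeff_deriv (hasDerivAt_of_contDiff_two hp) hc' hper 2
  set M := ∫ φ in (0 : ℝ)..(2 * π), p φ
  set Qc := ∫ ψ in (0 : ℝ)..(2 * π), p ψ ^ 2 * cos ψ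
  set Qs := ∫ ψ in (0 : ℝ)..(2 * π), p ψ ^ 2 * sin ψ
  have hexp : ∀ φ, 3 / 2 * p φ * M
      + 3 / 2 * (p φ * cos (2 * φ) - deriv p φ * sin (2 * φ)) * cosCoeff p 2
      + 3 / 2 * (p φ * sin (2 * φ) + deriv p φ * cos (2 * φ)) * sinCoeff p 2
      - 3 / 2 * cos φ * Qc - 3 / 2 * sin φ * Qs =
      3 / 2 * M * p φ + 3 / 2 * cosCoeff p 2 * (p φ * cos ((2 : ℤ) * φ))
      - 3 / 2 * cosCoeff p 2 * (deriv p φ * sin ((2 : ℤ) * φ))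
      + 3 / 2 * sinCoeff p 2 * (p φ * sin ((2 : ℤ) * φ))
      + 3 / 2 * sinCoeff p 2 * (deriv p φ * cos ((2 : ℤ) * φ))
      - 3 / 2 * Qc * cos φ - 3 / 2 * Qs * sin φ := by
    intro φ
    push_cast
    ring
  simp only [hexp] at h
  rw [intervalIntegral.integral_sub, intervalIntegral.integral_sub, intervalIntegral.integral_add,
    intervalIntegral.integral_add, intervalIntegral.integral_sub, intervalIntegral.integral_add,
    intervalIntegral.integral_const_mul, intervalIntegral.integral_const_mul,
    intervalIntegral.integral_const_mul, intervalIntegral.integral_const_mul,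
    intervalIntegral.integral_const_mul, intervalIntegral.integral_const_mul,
    intervalIntegral.integral_const_mul, hcos, hsin] at h
  · change 3 / 2 * M * M + 3 / 2 * cosCoeff p 2 * cosCoeff p 2
      - 3 / 2 * cosCoeff p 2 * sinCoeff (deriv p) 2 + 3 / 2 * sinCoeff p 2 * sinCoeff p 2
      + 3 / 2 * sinCoeff p 2 * cosCoeff (deriv p) 2 - 3 / 2 * Qc * 0 - 3 / 2 * Qs * 0 = _ at h
    rw [h1, h2] at h
    push_cast at h
    rw [power]
    linarith
  all_goals exact (by fun_prop : Continuous _).intervalIntegrable _ _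

/-! ### The remaining functionals -/

/-- The p' N terms cancel, leaving the radius of curvature p + p'' as speed. Since p'' integrates to
zero over a period, the length becomes ∫ p. -/
theorem hasDerivAt_boundaryCurve {K : Set Plane} (hsmooth : ContDiff ℝ 2 (supportFn K)) (φ : ℝ) :
    HasDerivAt (boundaryCurve K)
      ((supportFn K φ + deriv (deriv (supportFn K)) φ) • tangentVec φ) φ := by
  have h0 := hasDerivAt_of_contDiff_two hsmooth φ
  have h1 := hasDerivAt_deriv_of_contDiff_two hsmooth φ
  rw [hasDerivAt_iff_hasFDerivAt, ← hasFDerivWithinAt_univ, hasFDerivWithinAt_euclidean]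
  intro i
  rw [hasFDerivWithinAt_univ]
  fin_cases i
  · have h := (h0.mul (hasDerivAt_cos φ)).sub (h1.mul (hasDerivAt_sin φ))
    refine (h.hasFDerivAt.congr_fderiv (ContinuousLinearMap.ext fun v => ?_)).congr_of_eventuallyEq
      (Filter.Eventually.of_forall fun ψ => ?_)
    · simp [tangentVec]; ring
    · simp [boundaryCurve, envelope, normalVec, tangentVec]; ring
  · have h := (h0.mul (hasDerivAt_sin φ)).add (h1.mul (hasDerivAt_cos φ))
    refine (h.hasFDerivAt.congr_fderiv (ContinuousLinearMap.ext fun v => ?_)).congr_of_eventuallyEq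
      (Filter.Eventually.of_forall fun ψ => ?_)
    · simp [tangentVec]; left; ring
    · simp [boundaryCurve, envelope, normalVec, tangentVec]

theorem boundaryLength_eq {K : Set Plane} (hsmooth : ContDiff ℝ 2 (supportFn K))
    (hcurv : ∀ φ, 0 < supportFn K φ + deriv (deriv (supportFn K)) φ) :
    boundaryLength K = ∫ φ in (0 : ℝ)..(2 * π), supportFn K φ := by
  have hn : ∀ φ, ‖deriv (boundaryCurve K) φ‖ =
      supportFn K φ + deriv (deriv (supportFn K)) φ := by
    intro φ
    have h : ‖tangentVec φ‖ = 1 := by simp [EuclideanSpace.norm_eq, tangentVec]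
    rw [(hasDerivAt_boundaryCurve hsmooth φ).deriv, norm_smul, h, mul_one, Real.norm_eq_abs,
      abs_of_pos (hcurv φ)]
  have hc := hsmooth.continuous
  have hc'' := continuous_deriv_deriv_of_contDiff_two hsmooth
  rw [boundaryLength]
  simp only [hn]
  rw [intervalIntegral.integral_add (hc.intervalIntegrable _ _) (hc''.intervalIntegrable _ _),
    integral_deriv_of_periodic (hasDerivAt_deriv_of_contDiff_two hsmooth) hc''
      (periodic_deriv (periodic_supportFn K)), add_zero]

theorem boundaryLength_pos {K : Set Plane} (hsmooth : ContDiff ℝ 2 (supportFn K))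
    (hcurv : ∀ φ, 0 < supportFn K φ + deriv (deriv (supportFn K)) φ) :
    0 < ∫ φ in (0 : ℝ)..(2 * π), supportFn K φ := by
  have hc := hsmooth.continuous
  have hc'' := continuous_deriv_deriv_of_contDiff_two hsmooth
  have h : 0 < ∫ φ in (0 : ℝ)..(2 * π), (supportFn K φ + deriv (deriv (supportFn K)) φ) :=
    intervalIntegral.intervalIntegral_pos_of_pos ((hc.add hc'').intervalIntegrable _ _) hcurv
      (by positivity)
  rwa [intervalIntegral.integral_add (hc.intervalIntegrable _ _) (hc''.intervalIntegrable _ _),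
    integral_deriv_of_periodic (hasDerivAt_deriv_of_contDiff_two hsmooth) hc''
      (periodic_deriv (periodic_supportFn K)), add_zero] at h

theorem evoluteSupportFn_eq (K : Set Plane) (t : ℝ) :
    evoluteSupportFn K t = deriv (supportFn K) (t - π / 2) := by
  have h := sin_sq_add_cos_sq t
  rw [evoluteSupportFn, inner_normalVec]
  simp [boundaryCurve, envelope, normalVec, tangentVec, cos_sub_pi_div_two, sin_sub_pi_div_two]
  linear_combination (deriv (supportFn K) (t - π / 2)) * h

theorem signedArea_comp_sub {f : ℝ → ℝ} (hf : Function.Periodic f (2 * π)) (a : ℝ) :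
    signedArea (fun t => f (t - a)) = signedArea f := by
  have hd : ∀ t, deriv (fun t => f (t - a)) t = deriv f (t - a) := fun t =>
    deriv_comp_sub_const f a t
  rw [signedArea, signedArea]
  simp only [hd]
  rw [integral_comp_sub_of_periodic (f := fun t => f t ^ 2 - deriv f t ^ 2)]
  intro t
  simp only [hf t, periodic_deriv hf t]

theorem evoluteArea_eq (K : Set Plane) :
    evoluteArea K = signedArea (deriv (supportFn K)) := by
  rw [evoluteArea, funext (evoluteSupportFn_eq K),
    signedArea_comp_sub (periodic_deriv (periodic_supportFn K))]

theorem hasSum_signedArea {f f' : ℝ → ℝ} (hf : ∀ x, HasDerivAt f (f' x) x)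
    (hf' : Continuous f') (hfp : Function.Periodic f (2 * π)) :
    HasSum (fun n : ℤ => (1 - (n : ℝ) ^ 2) * power f n) (4 * π * signedArea f) := by
  have hc : Continuous f := continuous_iff_continuousAt.2 fun x => (hf x).continuousAt
  have h := (hasSum_power hc).sub (hasSum_power hf')
  have hd : deriv f = f' := funext fun x => (hf x).deriv
  have hs : 4 * π * signedArea f = 2 * π * (∫ θ in (0 : ℝ)..(2 * π), f θ ^ 2) -
      2 * π * ∫ θ in (0 : ℝ)..(2 * π), f' θ ^ 2 := by
    rw [signedArea, hd, intervalIntegral.integral_sub]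
    · ring
    all_goals exact (by fun_prop : Continuous _).intervalIntegrable _ _
  rw [hs]
  refine h.congr_fun fun n => ?_
  rw [power_deriv hf hf' hfp]
  ring

theorem supportFn_closedBall (c : Plane) {R : ℝ} (hR : 0 ≤ R) (φ : ℝ) :
    supportFn (Metric.closedBall c R) φ = ⟪c, normalVec φ⟫ + R := by
  have hn : ‖normalVec φ‖ = 1 := by simp [EuclideanSpace.norm_eq, normalVec]
  refine IsGreatest.csSup_eq ⟨⟨c + R • normalVec φ, ?_, ?_⟩, ?_⟩
  · simp [norm_smul, hn, abs_of_nonneg hR]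
  · simp only [inner_add_left, inner_smul_left, real_inner_self_eq_norm_sq, hn]
    simp
  · rintro _ ⟨x, hx, rfl⟩
    rw [mem_closedBall_iff_norm] at hx
    have h1 := real_inner_le_norm (x - c) (normalVec φ)
    rw [hn, mul_one, inner_sub_left] at h1
    simp only
    linarith

theorem eq_of_supportFn_eq {K D : Set Plane} (hK : K.Nonempty) (hK' : IsCompact K)
    (hK'' : Convex ℝ K) (hD : D.Nonempty) (hD' : IsCompact D) (hD'' : Convex ℝ D)
    (h : ∀ φ, supportFn K φ = supportFn D φ) : K = D := by
  ext x
  rw [mem_iff_inner_le_supportFn hK hK' hK'', mem_iff_inner_le_supportFn hD hD' hD'']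
  simp only [h]

theorem integral_smul_normalVec_apply {f : ℝ → ℝ} (hf : Continuous f) :
    (∫ φ in (0 : ℝ)..(2 * π), f φ • normalVec φ) = !₂[cosCoeff f 1, sinCoeff f 1] := by
  have hN : Continuous fun φ => f φ • normalVec φ := by
    unfold normalVec
    fun_prop
  have h : ∀ i : Fin 2, (∫ φ in (0 : ℝ)..(2 * π), f φ • normalVec φ) i =
      ∫ φ in (0 : ℝ)..(2 * π), (f φ • normalVec φ) i := fun i =>
    ((EuclideanSpace.proj (𝕜 := ℝ) i).intervalIntegral_comp_comm
      (hN.intervalIntegrable (μ := volume) 0 (2 * π))).symm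
  ext i
  rw [h]
  fin_cases i <;> simp [normalVec, cosCoeff, sinCoeff]

theorem meanWidth_eq {K : Set Plane} (hc : Continuous (supportFn K)) :
    meanWidth K / 2 = (∫ φ in (0 : ℝ)..(2 * π), supportFn K φ) / (2 * π) := by
  have h := integral_comp_sub_of_periodic (periodic_supportFn K) (-π)
  simp only [sub_neg_eq_add] at h
  rw [meanWidth, intervalIntegral.integral_add, h]
  · ring
  all_goals exact (by fun_prop : Continuous _).intervalIntegrable _ _

/-- The Steiner disk is the part of p of frequency at most 1: half the mean width is the mean of p,
and the Steiner point is its first harmonic. -/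
theorem sub_supportFn_steinerDisk {K : Set Plane} (hc : Continuous (supportFn K))
    (hM : 0 ≤ ∫ φ in (0 : ℝ)..(2 * π), supportFn K φ) (φ : ℝ) :
    supportFn K φ - supportFn (steinerDisk K) φ =
      removeFrequency 1 (removeMean (supportFn K)) φ := by
  rw [steinerDisk, meanWidth_eq hc, supportFn_closedBall _ (by positivity), steinerPoint,
    integral_smul_normalVec_apply hc, removeFrequency, cosCoeff_removeMean hc one_ne_zero,
    sinCoeff_removeMean hc, removeMean, trigMonomial, inner_normalVec]
  simp
  ring

/-! ### The Fourier series of the bound and of the Hurwitz deficit -/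

/-- `f` without its frequencies of absolute value at most `2`. -/
noncomputable def highPart (f : ℝ → ℝ) : ℝ → ℝ :=
  removeFrequency 2 (removeFrequency 1 (removeMean f))

theorem continuous_highPart {f : ℝ → ℝ} (hf : Continuous f) : Continuous (highPart f) :=
  continuous_removeFrequency _ (continuous_removeFrequency _ (continuous_removeMean hf))

theorem power_highPart {f : ℝ → ℝ} (hf : Continuous f) (n : ℤ) :
    power (highPart f) n = if |n| ≤ 2 then 0 else power f n := by
  rw [highPart, power_removeFrequency two_ne_zero
    (continuous_removeFrequency _ (continuous_removeMean hf)),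
    power_removeFrequency one_ne_zero (continuous_removeMean hf), power_removeMean hf]
  have : |n| ≤ 2 ↔ (n = 2 ∨ n = -2) ∨ (n = 1 ∨ n = -1) ∨ n = 0 := by
    rw [abs_le]; omega
  simp only [this]
  split_ifs <;> simp_all

theorem hasSum_deficitBound {K : Set Plane} (hne : K.Nonempty) (hcomp : IsCompact K)
    (hconv : Convex ℝ K) (hsmooth : ContDiff ℝ 2 (supportFn K))
    (hcurv : ∀ φ, 0 < supportFn K φ + deriv (deriv (supportFn K)) φ) :
    HasSum (fun n => 10 * power (highPart (supportFn K)) n) (deficitBound K) := by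
  have hc := hsmooth.continuous
  have hM := boundaryLength_pos hsmooth hcurv
  set q := removeFrequency 1 (removeMean (supportFn K)) with hq
  have hqc : Continuous q := continuous_removeFrequency _ (continuous_removeMean hc)
  have hδ : deltaTwo K ^ 2 = ∫ φ in (0 : ℝ)..(2 * π), q φ ^ 2 := by
    rw [deltaTwo, Real.sq_sqrt]
    · simp only [sub_supportFn_steinerDisk hc hM.le, hq]
    · exact intervalIntegral.integral_nonneg (by positivity) fun _ _ => sq_nonneg _
  have hS : power q 2 = power (supportFn K) 2 := by
    rw [hq, power_removeFrequency one_ne_zero (continuous_removeMean hc), power_removeMean hc]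
    simp
  -- The integral of sin³ ω, times 4/9, is L²/3 + `power p 2`. Twice this power is the joint share
  -- of n = 2 and n = -2 in Parseval's sum.
  have hD : deficitBound K = 10 * (2 * π * (∫ φ in (0 : ℝ)..(2 * π), q φ ^ 2)
      - power q 2 - power q 2) := by
    rw [deficitBound, hδ, boundaryLength_eq hsmooth hcurv,
      (integral_sin_visualAngle hne hcomp hconv hsmooth hcurv).2,
      integral_gapProduct hsmooth (periodic_supportFn K), hS]
    ring
  rw [hD]
  refine HasSum.mul_left 10 ?_
  refine (((hasSum_power hqc).sub (hasSum_ite_eq 2 (power q 2))).sub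
    (hasSum_ite_eq (-2) (power q 2))).congr_fun fun n => ?_
  rw [highPart, power_removeFrequency two_ne_zero hqc]
  by_cases h1 : n = 2
  · simp [h1]
  · by_cases h2 : n = -2
    · simp [h2, power_neg]
    · simp [h1, h2]

theorem int_sq_mul_one_sub_sq_nonpos (n : ℤ) : (n : ℝ) ^ 2 * (1 - (n : ℝ) ^ 2) ≤ 0 := by
  rcases eq_or_ne n 0 with rfl | h
  · simp
  · have h1 : (1 : ℤ) ≤ n ^ 2 := by
      have := pow_pos (abs_pos.2 h) 2
      rw [sq_abs] at this
      omega
    have h2 : (1 : ℝ) ≤ (n : ℝ) ^ 2 := by exact_mod_cast h1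
    exact mul_nonpos_of_nonneg_of_nonpos (by positivity) (by linarith)

/-- The area of the evolute is nonpositive, because n²(1 - n²) ≤ 0 for every integer, so |F_e| =
-F_e and the deficit is linear in the powers. -/
theorem hasSum_hurwitzDeficit {K : Set Plane} (hne : K.Nonempty) (hcomp : IsCompact K)
    (hconv : Convex ℝ K) (hsmooth : ContDiff ℝ 2 (supportFn K))
    (hcurv : ∀ φ, 0 < supportFn K φ + deriv (deriv (supportFn K)) φ) :
    HasSum (fun n : ℤ => ((n : ℝ) ^ 2 - 1) * ((n : ℝ) ^ 2 - 4) / 4 *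
      power (highPart (supportFn K)) n) (hurwitzDeficit K) := by
  have hc := hsmooth.continuous
  have hper := periodic_supportFn K
  have hF := hasSum_signedArea (hasDerivAt_of_contDiff_two hsmooth)
    (continuous_deriv_of_contDiff_two hsmooth) hper
  have hFe := hasSum_signedArea (hasDerivAt_deriv_of_contDiff_two hsmooth)
    (continuous_deriv_deriv_of_contDiff_two hsmooth) (periodic_deriv hper)
  have hpow : ∀ n, power (deriv (supportFn K)) n = (n : ℝ) ^ 2 * power (supportFn K) n :=
    power_deriv (hasDerivAt_of_contDiff_two hsmooth) (continuous_deriv_of_contDiff_two hsmooth) hper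
  have hnonpos : 4 * π * signedArea (deriv (supportFn K)) ≤ 0 := by
    refine hasSum_le (fun n => ?_) hFe hasSum_zero
    rw [hpow, ← mul_assoc, mul_comm (1 - _)]
    exact mul_nonpos_of_nonpos_of_nonneg (int_sq_mul_one_sub_sq_nonpos n) (power_nonneg _ _)
  have hneg : signedArea (deriv (supportFn K)) ≤ 0 :=
    nonpos_of_mul_nonpos_right hnonpos (by positivity)
  have hH : hurwitzDeficit K = -(1 / 4) * (4 * π * signedArea (deriv (supportFn K)))
      + 4 * π * signedArea (supportFn K) - power (supportFn K) 0 := by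
    rw [hurwitzDeficit, isoDeficit, evoluteArea_eq, abs_of_nonpos hneg,
      area_eq_signedArea hne hcomp hconv hsmooth hcurv, boundaryLength_eq hsmooth hcurv, power_zero]
    ring
  rw [hH]
  refine (((hFe.mul_left (-(1 / 4))).add hF).sub
    (hasSum_ite_eq 0 (power (supportFn K) 0))).congr_fun fun n => ?_
  rw [hpow, power_highPart hc]
  by_cases h : |n| ≤ 2
  · obtain ⟨h1, h2⟩ := abs_le.1 h
    interval_cases n <;> norm_num <;> ring
  · have h0 : n ≠ 0 := by rintro rfl; simp at h
    simp only [h, h0, if_false]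
    ring

theorem sixteen_le_sq {n : ℤ} (h : 4 ≤ |n|) : (16 : ℝ) ≤ (n : ℝ) ^ 2 := by
  have h1 : (4 : ℤ) ^ 2 ≤ n ^ 2 := sq_le_sq.2 (by simpa using h)
  have h2 : ((4 : ℤ) ^ 2 : ℝ) ≤ (n : ℝ) ^ 2 := by exact_mod_cast h1
  norm_num at h2
  exact h2

theorem power_highPart_term_nonneg {f : ℝ → ℝ} (hf : Continuous f) (n : ℤ) :
    0 ≤ (((n : ℝ) ^ 2 - 1) * ((n : ℝ) ^ 2 - 4) / 4 - 10) * power (highPart f) n := by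
  rw [power_highPart hf]
  split_ifs with h
  · simp
  · refine mul_nonneg ?_ (power_nonneg _ _)
    have h1 : (3 : ℤ) ^ 2 ≤ n ^ 2 := sq_le_sq.2 (by rw [abs_of_nonneg (by norm_num)]; omega)
    have h2 : ((3 : ℤ) ^ 2 : ℝ) ≤ (n : ℝ) ^ 2 := by exact_mod_cast h1
    norm_num at h2
    nlinarith

theorem power_highPart_term_eq_zero_iff {f : ℝ → ℝ} (hf : Continuous f) (n : ℤ) :
    (((n : ℝ) ^ 2 - 1) * ((n : ℝ) ^ 2 - 4) / 4 - 10) * power (highPart f) n = 0 ↔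
      (4 ≤ |n| → power f n = 0) := by
  rw [power_highPart hf]
  by_cases h : 4 ≤ |n|
  · have h2 := sixteen_le_sq h
    have h3 : ((n : ℝ) ^ 2 - 1) * ((n : ℝ) ^ 2 - 4) / 4 - 10 ≠ 0 := by
      apply ne_of_gt
      nlinarith
    simp [h, h3, show ¬ |n| ≤ 2 by omega]
  · simp only [h, false_imp_iff, iff_true]
    split_ifs with h'
    · simp
    · have h1 : |n| = |3| := by rw [abs_of_nonneg (by norm_num : (0 : ℤ) ≤ 3)]; omega
      have h2 : n ^ 2 = 3 ^ 2 := sq_eq_sq_iff_abs_eq_abs _ _ |>.2 h1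
      have h3 : (n : ℝ) ^ 2 = 3 ^ 2 := by exact_mod_cast h2
      rw [h3]
      norm_num

/-- The difference is a series of nonnegative terms, so it vanishes only termwise. The weight
difference is 0 at ±3, hence frequency 3 stays free, and it is positive from 4 on. -/
theorem hurwitzDeficit_eq_deficitBound_iff {K : Set Plane} (hne : K.Nonempty) (hcomp : IsCompact K)
    (hconv : Convex ℝ K) (hsmooth : ContDiff ℝ 2 (supportFn K))
    (hcurv : ∀ φ, 0 < supportFn K φ + deriv (deriv (supportFn K)) φ) :
    hurwitzDeficit K = deficitBound K ↔ ∀ n : ℤ, 4 ≤ |n| → power (supportFn K) n = 0 := by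
  have h := ((hasSum_hurwitzDeficit hne hcomp hconv hsmooth hcurv).sub
    (hasSum_deficitBound hne hcomp hconv hsmooth hcurv)).congr_fun
      (g := fun n : ℤ => (((n : ℝ) ^ 2 - 1) * ((n : ℝ) ^ 2 - 4) / 4 - 10) *
        power (highPart (supportFn K)) n) (fun n => by ring)
  have hnn := power_highPart_term_nonneg hsmooth.continuous
  rw [← sub_eq_zero]
  simp only [← power_highPart_term_eq_zero_iff hsmooth.continuous]
  constructor
  · intro h0
    rw [h0] at h
    exact congrFun ((hasSum_zero_iff_of_nonneg hnn).1 h)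
  · intro h0
    rw [funext h0] at h
    exact h.unique hasSum_zero

theorem deficitBound_le_hurwitzDeficit {K : Set Plane} (hne : K.Nonempty) (hcomp : IsCompact K)
    (hconv : Convex ℝ K) (hsmooth : ContDiff ℝ 2 (supportFn K))
    (hcurv : ∀ φ, 0 < supportFn K φ + deriv (deriv (supportFn K)) φ) :
    deficitBound K ≤ hurwitzDeficit K :=
  hasSum_le (fun n => by
    have := power_highPart_term_nonneg hsmooth.continuous n
    linarith) (hasSum_deficitBound hne hcomp hconv hsmooth hcurv)
    (hasSum_hurwitzDeficit hne hcomp hconv hsmooth hcurv)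

theorem deficitBound_nonneg {K : Set Plane} (hne : K.Nonempty) (hcomp : IsCompact K)
    (hconv : Convex ℝ K) (hsmooth : ContDiff ℝ 2 (supportFn K))
    (hcurv : ∀ φ, 0 < supportFn K φ + deriv (deriv (supportFn K)) φ) : 0 ≤ deficitBound K :=
  (hasSum_deficitBound hne hcomp hconv hsmooth hcurv).nonneg fun n =>
    mul_nonneg (by norm_num) (power_nonneg _ _)

/-- Both series involve the same powers of `highPart`, and in the bound all of them carry the
positive weight 10. -/
theorem hurwitzDeficit_eq_zero_of_deficitBound_eq_zero {K : Set Plane} (hne : K.Nonempty)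
    (hcomp : IsCompact K) (hconv : Convex ℝ K) (hsmooth : ContDiff ℝ 2 (supportFn K))
    (hcurv : ∀ φ, 0 < supportFn K φ + deriv (deriv (supportFn K)) φ) (h : deficitBound K = 0) :
    hurwitzDeficit K = 0 := by
  have h1 := hasSum_deficitBound hne hcomp hconv hsmooth hcurv
  rw [h, hasSum_zero_iff_of_nonneg fun n => mul_nonneg (by norm_num) (power_nonneg _ _)] at h1
  have h2 : ∀ n, power (highPart (supportFn K)) n = 0 := fun n => by
    have := congrFun h1 n
    simpa using this
  have h3 := hasSum_hurwitzDeficit hne hcomp hconv hsmooth hcurv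
  simp only [h2, mul_zero] at h3
  exact h3.unique hasSum_zero

/-! ### The case of equality -/

theorem hypocycloidSupportFn_four (r α θ : ℝ) : hypocycloidSupportFn 4 r (θ - α) =
    trigMonomial 2 (-(2 * r * sin (2 * α))) (2 * r * cos (2 * α)) θ := by
  rw [hypocycloidSupportFn, trigMonomial, show (4 : ℝ) / (4 - 2) * (θ - α) = 2 * θ - 2 * α by ring,
    sin_sub]
  push_cast
  ring

theorem hypocycloidSupportFn_three (r α θ : ℝ) : hypocycloidSupportFn 3 r (θ - α) =
    trigMonomial 3 (-(r * sin (3 * α))) (r * cos (3 * α)) θ := by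
  rw [hypocycloidSupportFn, trigMonomial, show (3 : ℝ) / (3 - 2) * (θ - α) = 3 * θ - 3 * α by ring,
    sin_sub]
  push_cast
  ring

/-- The signs match the expansion of r sin(kθ - β) into cosine and sine. -/
theorem exists_pos_polar {x y : ℝ} (h : ¬ (x = 0 ∧ y = 0)) :
    ∃ r β : ℝ, 0 < r ∧ x = -(r * sin β) ∧ y = r * cos β := by
  refine ⟨‖(⟨y, -x⟩ : ℂ)‖, Complex.arg ⟨y, -x⟩, ?_, ?_, ?_⟩
  · rw [norm_pos_iff, ne_eq, Complex.ext_iff]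
    simpa [and_comm] using h
  · rw [Complex.norm_mul_sin_arg, neg_neg]
  · rw [Complex.norm_mul_cos_arg]

theorem inner_normalVec_eq_trigMonomial (c : Plane) (θ : ℝ) :
    ⟪c, normalVec θ⟫ = trigMonomial 1 (c 0) (c 1) θ := by
  rw [inner_normalVec, trigMonomial]
  simp

theorem isParallelToHypocycloid_four {h : ℝ → ℝ} {d x y u v : ℝ} (huv : ¬ (u = 0 ∧ v = 0))
    (hh : ∀ θ, h θ = d + trigMonomial 1 x y θ + trigMonomial 2 u v θ) : IsParallelToHypocycloid 4 h := by
  obtain ⟨r, β, hr, rfl, rfl⟩ := exists_pos_polar huv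
  -- The astroid has amplitude 2r in its support function, and a rotation by α shifts the phase of
  -- frequency 2 by 2α.
  refine ⟨r / 2, by positivity, β / 2, d, !₂[x, y], fun θ => ?_⟩
  rw [hh, inner_normalVec_eq_trigMonomial, hypocycloidSupportFn_four]
  simp only [mul_div_cancel₀ _ (two_ne_zero' ℝ)]
  simp
  ring

theorem isParallelToHypocycloid_three {h : ℝ → ℝ} {d x y u v : ℝ} (huv : ¬ (u = 0 ∧ v = 0))
    (hh : ∀ θ, h θ = d + trigMonomial 1 x y θ + trigMonomial 3 u v θ) : IsParallelToHypocycloid 3 h := by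
  obtain ⟨r, β, hr, rfl, rfl⟩ := exists_pos_polar huv
  refine ⟨r, hr, β / 3, d, !₂[x, y], fun θ => ?_⟩
  rw [hh, inner_normalVec_eq_trigMonomial, hypocycloidSupportFn_three,
    mul_div_cancel₀ _ (three_ne_zero' ℝ)]
  simp
  ring

theorem trigMonomial_zero (k : ℤ) (θ : ℝ) : trigMonomial k 0 0 θ = 0 := by simp [trigMonomial]

/-- `f` is continuous and has no frequencies above `3`. -/
def HasLowFrequencies (f : ℝ → ℝ) : Prop :=
  Continuous f ∧ ∀ n : ℤ, 4 ≤ |n| → cosCoeff f n = 0 ∧ sinCoeff f n = 0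

/-- Coefficients are linear while `power` is not; Minkowski sums therefore call for vanishing
coefficients instead of vanishing powers. -/
theorem HasLowFrequencies.sub {f g : ℝ → ℝ} (hf : HasLowFrequencies f) (hg : HasLowFrequencies g) :
    HasLowFrequencies fun θ => f θ - g θ := by
  refine ⟨hf.1.sub hg.1, fun n hn => ?_⟩
  rw [cosCoeff_sub hf.1 hg.1, sinCoeff_sub hf.1 hg.1, (hf.2 n hn).1, (hf.2 n hn).2, (hg.2 n hn).1,
    (hg.2 n hn).2, sub_zero]
  exact ⟨rfl, rfl⟩

theorem hasLowFrequencies_trigMonomial {k : ℤ} (hk : |k| ≤ 3) (x y : ℝ) :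
    HasLowFrequencies (trigMonomial k x y) := by
  refine ⟨continuous_trigMonomial _ _ _, fun n hn => ?_⟩
  have h : n ^ 2 ≠ k ^ 2 := by
    rw [ne_eq, sq_eq_sq_iff_abs_eq_abs]
    omega
  exact ⟨cosCoeff_trigMonomial_of_ne h x y, sinCoeff_trigMonomial_of_ne h x y⟩

theorem hasLowFrequencies_const (c : ℝ) : HasLowFrequencies fun _ => c := by
  have h := hasLowFrequencies_trigMonomial (k := 0) (by simp) c 0
  have e : trigMonomial 0 c 0 = fun _ => c := by funext θ; simp [trigMonomial]
  rwa [e] at h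

theorem HasLowFrequencies.add {f g : ℝ → ℝ} (hf : HasLowFrequencies f) (hg : HasLowFrequencies g) :
    HasLowFrequencies fun θ => f θ + g θ := by
  have h := hf.sub ((hasLowFrequencies_const 0).sub hg)
  simpa using h

theorem HasLowFrequencies.sum {m : ℕ} {h : Fin m → ℝ → ℝ} (hh : ∀ i, HasLowFrequencies (h i)) :
    HasLowFrequencies fun θ => ∑ i, h i θ := by
  induction m with
  | zero => simpa using hasLowFrequencies_const 0
  | succ m ih =>
    simp only [Fin.sum_univ_succ]
    exact (hh 0).add (ih fun i => hh i.succ)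

theorem HasLowFrequencies.power_eq_zero {f : ℝ → ℝ} (hf : HasLowFrequencies f) {n : ℤ}
    (hn : 4 ≤ |n|) : power f n = 0 := by
  rw [power, (hf.2 n hn).1, (hf.2 n hn).2]
  norm_num

theorem hasLowFrequencies_supportFn_of_isDisk {D : Set Plane} (hD : IsDisk D) :
    HasLowFrequencies (supportFn D) := by
  obtain ⟨c, R, hR, rfl⟩ := hD
  have e : supportFn (Metric.closedBall c R) = fun θ => trigMonomial 1 (c 0) (c 1) θ + R :=
    funext fun θ => by rw [supportFn_closedBall c hR.le, inner_normalVec_eq_trigMonomial]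
  rw [e]
  exact (hasLowFrequencies_trigMonomial (by norm_num) _ _).add (hasLowFrequencies_const R)

theorem IsParallelToHypocycloid.hasLowFrequencies_four {h : ℝ → ℝ}
    (hh : IsParallelToHypocycloid 4 h) : HasLowFrequencies h := by
  obtain ⟨r, -, α, d, c, hh⟩ := hh
  simp only [inner_normalVec_eq_trigMonomial, hypocycloidSupportFn_four] at hh
  rw [funext hh]
  exact ((hasLowFrequencies_trigMonomial (by norm_num) _ _).add
    (hasLowFrequencies_trigMonomial (by norm_num) _ _)).add (hasLowFrequencies_const d)

theorem IsParallelToHypocycloid.hasLowFrequencies_three {h : ℝ → ℝ}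
    (hh : IsParallelToHypocycloid 3 h) : HasLowFrequencies h := by
  obtain ⟨r, -, α, d, c, hh⟩ := hh
  simp only [inner_normalVec_eq_trigMonomial, hypocycloidSupportFn_three] at hh
  rw [funext hh]
  exact ((hasLowFrequencies_trigMonomial (by norm_num) _ _).add
    (hasLowFrequencies_trigMonomial (by norm_num) _ _)).add (hasLowFrequencies_const d)

theorem IsSummandSupportFn.hasLowFrequencies {h : ℝ → ℝ} (hh : IsSummandSupportFn h) :
    HasLowFrequencies h := by
  rcases hh with ⟨D, hD, rfl⟩ | hh | hh
  · exact hasLowFrequencies_supportFn_of_isDisk hD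
  · exact hh.hasLowFrequencies_four
  · exact hh.hasLowFrequencies_three

/-- Removing the mean and the frequencies 1, 2 and 3 leaves a continuous periodic function with all
powers zero, hence the zero function. -/
theorem eq_trigMonomials_of_power_eq_zero {f : ℝ → ℝ} (hf : Continuous f)
    (hfp : Function.Periodic f (2 * π)) (h : ∀ n : ℤ, 4 ≤ |n| → power f n = 0) :
    ∃ x₁ y₁ x₂ y₂ x₃ y₃ : ℝ, ∀ θ, f θ = (∫ θ in (0 : ℝ)..(2 * π), f θ) / (2 * π)
      + trigMonomial 1 x₁ y₁ θ + trigMonomial 2 x₂ y₂ θ + trigMonomial 3 x₃ y₃ θ := by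
  have hc := continuous_highPart hf
  have hzero : ∀ θ, removeFrequency 3 (highPart f) θ = 0 := by
    refine eq_zero_of_power_eq_zero (continuous_removeFrequency 3 hc) ?_ fun n => ?_
    · intro θ
      simp only [highPart, removeFrequency, removeMean, periodic_trigMonomial _ _ _ θ, hfp θ]
    · rw [power_removeFrequency three_ne_zero hc, power_highPart hf]
      split_ifs with h1 h2
      · rfl
      · rfl
      · refine h n ?_
        rw [not_or] at h1
        have : |n| ≠ 3 := by
          intro h3
          rcases (abs_eq (by norm_num)).1 h3 with h4 | h4
          · exact h1.1 h4
          · exact h1.2 h4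
        omega
  refine ⟨cosCoeff (removeMean f) 1 / π, sinCoeff (removeMean f) 1 / π,
    cosCoeff (removeFrequency 1 (removeMean f)) 2 / π,
    sinCoeff (removeFrequency 1 (removeMean f)) 2 / π, cosCoeff (highPart f) 3 / π,
    sinCoeff (highPart f) 3 / π, fun θ => ?_⟩
  have h0 : removeMean f θ = f θ - (∫ θ in (0 : ℝ)..(2 * π), f θ) / (2 * π) := rfl
  have h1 : removeFrequency 1 (removeMean f) θ = removeMean f θ - trigMonomial 1
    (cosCoeff (removeMean f) 1 / π) (sinCoeff (removeMean f) 1 / π) θ := rfl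
  have h2 : highPart f θ = removeFrequency 1 (removeMean f) θ - trigMonomial 2
    (cosCoeff (removeFrequency 1 (removeMean f)) 2 / π)
    (sinCoeff (removeFrequency 1 (removeMean f)) 2 / π) θ := rfl
  have h3 : highPart f θ - trigMonomial 3 (cosCoeff (highPart f) 3 / π)
    (sinCoeff (highPart f) 3 / π) θ = 0 := hzero θ
  linarith

/-- The four outcomes correspond to whether the harmonics 2 and 3 vanish. The mean of p is positive
because p + p'' is, which provides the radius in the case of a disk. -/
theorem isDisk_or_parallel_or_isMinkowskiSum (K : Set Plane) (hne : K.Nonempty) (hcomp : IsCompact K)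
    (hconv : Convex ℝ K) (hsmooth : ContDiff ℝ 2 (supportFn K))
    (hcurv : ∀ φ, 0 < supportFn K φ + deriv (deriv (supportFn K)) φ)
    (h : ∀ n : ℤ, 4 ≤ |n| → power (supportFn K) n = 0) :
      (IsDisk K ∨ IsBoundedByAstroidParallel K) ∨
        IsBoundedBySteinerParallel K ∨ IsMinkowskiSumOfSummands K := by
  obtain ⟨x₁, y₁, x₂, y₂, x₃, y₃, hK⟩ :=
    eq_trigMonomials_of_power_eq_zero hsmooth.continuous (periodic_supportFn K) h
  have hM := boundaryLength_pos hsmooth hcurv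
  set d := (∫ θ in (0 : ℝ)..(2 * π), supportFn K θ) / (2 * π) with hd
  have hdpos : 0 < d := by positivity
  by_cases h2 : x₂ = 0 ∧ y₂ = 0
  · by_cases h3 : x₃ = 0 ∧ y₃ = 0
    · left; left
      refine ⟨!₂[x₁, y₁], d, hdpos, ?_⟩
      refine eq_of_supportFn_eq hne hcomp hconv (Metric.nonempty_closedBall.2 hdpos.le)
        (isCompact_closedBall _ _) (convex_closedBall _ _) fun φ => ?_
      rw [supportFn_closedBall _ hdpos.le, hK, h2.1, h2.2, h3.1, h3.2, trigMonomial_zero, trigMonomial_zero,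
        inner_normalVec_eq_trigMonomial]
      simp
      ring
    · right; left
      refine isParallelToHypocycloid_three (d := d) (x := x₁) (y := y₁) h3 fun θ => ?_
      rw [hK, h2.1, h2.2, trigMonomial_zero, add_zero]
  · by_cases h3 : x₃ = 0 ∧ y₃ = 0
    · left; right
      refine isParallelToHypocycloid_four (d := d) (x := x₁) (y := y₁) h2 fun θ => ?_
      rw [hK, h3.1, h3.2, trigMonomial_zero, add_zero]
    · right; right
      -- The constant and the translation are both given to the astroid summand; the Steiner summand
      -- is centred with offset 0.
      refine ⟨2, ![fun θ => d + trigMonomial 1 x₁ y₁ θ + trigMonomial 2 x₂ y₂ θ,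
        fun θ => 0 + trigMonomial 1 0 0 θ + trigMonomial 3 x₃ y₃ θ], le_rfl, ?_, fun φ => ?_⟩
      · intro i
        fin_cases i
        · exact Or.inr (Or.inl (isParallelToHypocycloid_four h2 fun θ => rfl))
        · exact Or.inr (Or.inr (isParallelToHypocycloid_three h3 fun θ => rfl))
      · rw [hK, Fin.sum_univ_two]
        simp [trigMonomial_zero]

end PlaneConvex

/-! ### Assembly of the theorem -/

theorem mainTheorem6 (K : Set Plane) (hne : K.Nonempty) (hcomp : IsCompact K)
    (hconv : Convex ℝ K) (hsmooth : ContDiff ℝ 2 (supportFn K))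
    (hcurv : ∀ φ, 0 < supportFn K φ + deriv (deriv (supportFn K)) φ) :
    IntegrableOn (fun P => sin (visualAngle K P) ^ 3) Kᶜ volume ∧
    deficitBound K ≤ hurwitzDeficit K ∧
    (hurwitzDeficit K ≠ 0 → 0 < deficitBound K) ∧
    (hurwitzDeficit K = 0 → deficitBound K = 0) ∧
    (hurwitzDeficit K = deficitBound K ↔
      (IsDisk K ∨ IsBoundedByAstroidParallel K) ∨
        IsBoundedBySteinerParallel K ∨ IsMinkowskiSumOfSummands K) := by
  have hle := deficitBound_le_hurwitzDeficit hne hcomp hconv hsmooth hcurv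
  have hnn := deficitBound_nonneg hne hcomp hconv hsmooth hcurv
  refine ⟨(integral_sin_visualAngle hne hcomp hconv hsmooth hcurv).1, hle, fun h => ?_,
    fun h => le_antisymm (h ▸ hle) hnn, ?_⟩
  · exact lt_of_le_of_ne hnn fun h0 =>
      h (hurwitzDeficit_eq_zero_of_deficitBound_eq_zero hne hcomp hconv hsmooth hcurv h0.symm)
  rw [hurwitzDeficit_eq_deficitBound_iff hne hcomp hconv hsmooth hcurv]
  refine ⟨isDisk_or_parallel_or_isMinkowskiSum K hne hcomp hconv hsmooth hcurv, fun h n hn => ?_⟩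
  have hlow : HasLowFrequencies (supportFn K) := by
    rcases h with (h | h) | h | ⟨m, f, -, hf, hK⟩
    · exact hasLowFrequencies_supportFn_of_isDisk h
    · exact IsParallelToHypocycloid.hasLowFrequencies_four h
    · exact IsParallelToHypocycloid.hasLowFrequencies_three h
    · rw [funext hK]
      exact HasLowFrequencies.sum fun i => (hf i).hasLowFrequencies
  exact hlow.power_eq_zero hn
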